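/- **Model.** Let $\varphi:\mathbb R\to[0,\infty)$ be non-decreasing with $\lim_{x\to-\infty}\varphi(x)=0$ and $\lim_{x\to\infty}\varphi(x)=\infty$, and suppose that either $\varphi>0$ everywhere, or $\varphi$ is $0$ below some level and strictly increasing above it. Let $c>0$, $\alpha>0$, $k\ge 0$. Let $\Pi$ be a Poisson field of intensity $1$ on the positive quadrant $(0,\infty)^2$, let $(Z_n)_{n\ge1}$ be i.i.d. a.s. positive random variables with finite mean, independent of $\Pi$, and let $X_0\in\mathbb R$, $Y_0\ge 0$ be random variables with $(X_0,Y_0)$ independent of $(\Pi,(Z_n)_{n\ge 1})$. Let $N$ be a simple, locally finite point process on $(0,\infty)$ (the times of the earthquakes), write $N(t)=N((0,t])$, and put, for $t\ge0$, $$X(t)=X_0+ct-\sum_{n=1}^{N(t)}Z_n,\qquad Y(t)=Y_0e^{-\alpha t}+k\int_{(0,t]}e^{-\alpha(t-s)}\,N(ds),\qquad \lambda(t)=\varphi(X(t))+Y(t).$$ Suppose that $N$ is driven by $\Pi$ with intensity $\lambda(t)$, i.e. almost surely, for all $t\ge0$, $$N(t)=\int_{(0,t]}\int \mathbf 1(z\le\lambda(s-))\,\Pi(ds\times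 dz).$$ Here $\varphi(X(t))$ is the intensity of the primary earthquakes and $Y(t)$ that of the secondary earthquakes (aftershocks). **(1) Average rates.** Suppose that the process $(X(t),Y(t))_{t\ge0}$ is stationary and ergodic (the law of its path is invariant under time shifts, and shift-invariant measurable sets of paths have probability $0$ or $1$), and that the average intensity $\lambda:=E[\lambda(0)]$ satisfies $0<\lambda<\infty$. Then for every $t\ge 0$ the variables $\varphi(X(t))$ and $Y(t)$ are integrable, and $$E[\lambda(t)]=\lambda=\frac{c}{E[Z_1]},\qquad E[Y(t)]=\lambda\,\frac{k}{\alpha},\qquad E[\varphi(X(t))]=\lambda\Bigl(1-\frac{k}{\alpha}\Bigr).$$ **(2) Stationary processes converging to a constant.** Let $E$ be a metrizable space with its Borel $\sigma$-field (for instance $\mathbb R$), let $(V(t))_{t\ge0}$ be a stationary $E$-valued stochastic process and $a\in E$ a deterministic point such that $V(t)\to a$ almost surely as $t\uparrow\infty$. Then $P(V(t)=a)=1$ for every $t\ge0$. -/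

import Mathlib

open MeasureTheory ProbabilityTheory Filter Topology
open scoped NNReal ENNReal

noncomputable section

/-- The positive quadrant. -/
def quadrant : Set (ℝ × ℝ) := Set.Ioi 0 ×ˢ Set.Ioi 0

/-- `Pi` is a Poisson field of intensity `1` on the positive quadrant: a random measure for which
the number of points in a measurable set is Poisson distributed with mean the area of the part of
the set that lies in the quadrant, whenever this area is finite, and the numbers of points in
disjoint measurable sets are independent. -/
structure IsPoissonField {Ω : Type*} [MeasurableSpace Ω] (P : Measure Ω)
    (Pi : Ω → Measure (ℝ × ℝ)) : Prop where
  measurable : Measurable Pi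
  poisson : ∀ B : Set (ℝ × ℝ), MeasurableSet B → volume (B ∩ quadrant) < ∞ →
    P.map (fun ω => Pi ω B) =
      (poissonMeasure (volume (B ∩ quadrant)).toNNReal).map (fun n : ℕ => (n : ℝ≥0∞))
  indep : ∀ (m : ℕ) (B : Fin m → Set (ℝ × ℝ)), (∀ i, MeasurableSet (B i)) →
    Pairwise (fun i j => Disjoint (B i) (B j)) → iIndepFun (fun i ω => Pi ω (B i)) P

/-- The standing assumptions on the stress response function `φ`. -/
structure IsStressResponse (φ : ℝ → ℝ) : Prop where
  nonneg : ∀ x, 0 ≤ φ x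
  mono : Monotone φ
  tendsto_atBot : Tendsto φ atBot (𝓝 0)
  tendsto_atTop : Tendsto φ atTop atTop
  pos_or_strict : (∀ x, 0 < φ x) ∨
    ∃ x₀ : ℝ, (∀ x < x₀, φ x = 0) ∧ StrictMonoOn φ (Set.Ioi x₀)

/-- `N(t) = N((0, t])`, the number of shocks up to time `t`, for the set `S ⊆ (0, ∞)` of the
times of the shocks. -/
def shockCount (S : Set ℝ) (t : ℝ) : ℕ := (S ∩ Set.Ioc 0 t).ncard

/-- `X(t) = X₀ + c t - ∑_{n=1}^{N(t)} Z_n`. The sequence is indexed from `0`, so that `Z n` is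
the `(n+1)`-st stress release. -/
def stress {Ω : Type*} (c : ℝ) (Z : ℕ → Ω → ℝ) (X₀ : Ω → ℝ) (S : Ω → Set ℝ)
    (t : ℝ) (ω : Ω) : ℝ :=
  X₀ ω + c * t - ∑ n ∈ Finset.range (shockCount (S ω) t), Z n ω

/-- `Y(t) = Y₀ e^{-α t} + k ∫_{(0,t]} e^{-α (t-s)} dN(s)`, the intensity of the aftershocks; the
integral against the counting measure of the (locally finite) set of shocks is a finite sum. -/
def secondaryIntensity {Ω : Type*} (α k : ℝ) (Y₀ : Ω → ℝ) (S : Ω → Set ℝ)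
    (t : ℝ) (ω : Ω) : ℝ :=
  Y₀ ω * Real.exp (-α * t) +
    k * ∑ᶠ s ∈ S ω ∩ Set.Ioc 0 t, Real.exp (-α * (t - s))

/-- `φ(X(t))`, the intensity of the primary shocks. -/
def primaryIntensity {Ω : Type*} (φ : ℝ → ℝ) (c : ℝ) (Z : ℕ → Ω → ℝ) (X₀ : Ω → ℝ)
    (S : Ω → Set ℝ) (t : ℝ) (ω : Ω) : ℝ :=
  φ (stress c Z X₀ S t ω)

/-- `λ(t) = φ(X(t)) + Y(t)`, the stochastic intensity of the shocks. -/
def totalIntensity {Ω : Type*} (φ : ℝ → ℝ) (c α k : ℝ) (Z : ℕ → Ω → ℝ) (X₀ Y₀ : Ω → ℝ)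
    (S : Ω → Set ℝ) (t : ℝ) (ω : Ω) : ℝ :=
  primaryIntensity φ c Z X₀ S t ω + secondaryIntensity α k Y₀ S t ω

/-- The earthquake model driven by the Poisson field `Pi`, the stress releases `Z` and the initial
values `X₀`, `Y₀`. The set `S ω` holds the times of the shocks. -/
structure IsEarthquakeModel {Ω : Type*} [MeasurableSpace Ω] (P : Measure Ω)
    (φ : ℝ → ℝ) (c α k : ℝ) (Pi : Ω → Measure (ℝ × ℝ)) (Z : ℕ → Ω → ℝ)
    (X₀ Y₀ : Ω → ℝ) (S : Ω → Set ℝ) : Prop where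
  response : IsStressResponse φ
  c_pos : 0 < c
  alpha_pos : 0 < α
  k_nonneg : 0 ≤ k
  poissonField : IsPoissonField P Pi
  measurable_Z : ∀ n, Measurable (Z n)
  Z_pos : ∀ n, ∀ᵐ ω ∂P, 0 < Z n ω
  Z_indep : iIndepFun Z P
  Z_ident : ∀ n, IdentDistrib (Z n) (Z 0) P P
  Z_integrable : Integrable (Z 0) P
  indep_field_Z : IndepFun Pi (fun ω n => Z n ω) P
  measurable_X₀ : Measurable X₀
  measurable_Y₀ : Measurable Y₀
  Y₀_nonneg : ∀ᵐ ω ∂P, 0 ≤ Y₀ ω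
  indep_init : IndepFun (fun ω => (X₀ ω, Y₀ ω)) (fun ω => (Pi ω, fun n => Z n ω)) P
  /-- The shocks form a simple point process on `(0, ∞)`. -/
  shocks_pos : ∀ ω, S ω ⊆ Set.Ioi 0
  shocks_locallyFinite : ∀ ω t, (S ω ∩ Set.Ioc 0 t).Finite
  measurable_count : ∀ t, Measurable (fun ω => shockCount (S ω) t)
  /-- `N(t) = ∫_{(0,t]} ∫ 1(z ≤ λ(s-)) Pi(ds × dz)` for all `t`, almost surely. -/
  thinning : ∀ᵐ ω ∂P, ∀ t : ℝ, 0 ≤ t → (shockCount (S ω) t : ℝ≥0∞) =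
    Pi ω {p : ℝ × ℝ | 0 < p.1 ∧ p.1 ≤ t ∧
      p.2 ≤ Function.leftLim (fun u => totalIntensity φ c α k Z X₀ Y₀ S u ω) p.1}

/-- The process `V` is stationary: the law of the whole path (on the product σ-field) is invariant
under time shifts. -/
def IsStationaryProcess {Ω E : Type*} [MeasurableSpace Ω] [MeasurableSpace E]
    (P : Measure Ω) (V : ℝ≥0 → Ω → E) : Prop :=
  (∀ t, Measurable (V t)) ∧
    ∀ s : ℝ≥0, P.map (fun ω (t : ℝ≥0) => V (s + t) ω) = P.map (fun ω (t : ℝ≥0) => V t ω)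

/-- The (stationary) process `V` is ergodic: each shift-invariant measurable set of paths has
probability `0` or `1`. -/
def IsErgodicProcess {Ω E : Type*} [MeasurableSpace Ω] [MeasurableSpace E]
    (P : Measure Ω) (V : ℝ≥0 → Ω → E) : Prop :=
  ∀ A : Set (ℝ≥0 → E), MeasurableSet A →
    (∀ s : ℝ≥0, (fun (v : ℝ≥0 → E) (t : ℝ≥0) => v (s + t)) ⁻¹' A = A) →
    P {ω | (fun t => V t ω) ∈ A} = 0 ∨ P {ω | (fun t => V t ω) ∈ A} = 1

end

/-! The rates rest on three balance relations.

Compensation: `E[N(t)] = t E[λ(0)]`. The intensity at time `s` is a function of the history up to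
`s` (modulo null sets), and the field after `s` is independent of that history. So a strip that
starts at `s`, with a height read off from `λ(s)`, has mean mass equal to its length times the mean
height. Strips over a fine grid approximate the region below `λ(s-)` from both sides, and Fatou's
lemma and its reverse pass to the limit (`IsEarthquakeModel.lintegral_count`). Adaptedness is proved
by induction on the shocks: given the first `n` of them, the next is decided by the field under an
explicit curve (`lt_shockCount_iff_field_pos`).

Stress balance: `E[N(1)] = c / E[Z₁]`. Since `X(n)` has the law of `X(0)`, `X(n)/n` tends to `0` in
probability. Along a subsequence the convergence is almost sure, and the law of large numbers for
`Z` then forces `N(n)/n → c / E[Z₁]`. The quotients `N(n)/n` are uniformly integrable with constant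
mean `E[N(1)]`, so the limit is this mean (`IsEarthquakeModel.integral_count_one`). Stationarity is
assumed for `(X, Y)` only. It passes to the increments of `N` because the shocks can be read off
from the path of `X`.

Aftershock balance: `α E[Y(0)] = k E[λ(0)]`. Over a short time `t` the mean of `Y` loses about `α t
E[Y(0)]` by decay, gains about `k E[N(t)]`, and does not change.

For the statement on convergence to a constant, the mean of a bounded distance to `a` does not
depend on time and tends to `0`. -/

/-! ### Means and independence for the Poisson field -/

theorem lintegral_natCast_poissonMeasure (r : ℝ≥0) :
    ∫⁻ n, (n : ℝ≥0∞) ∂(poissonMeasure r) = r := by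
  have h : ∀ n : ℕ, ENNReal.ofReal (Real.exp (-r) * r ^ n / n.factorial) * n =
      ENNReal.ofReal (n * (Real.exp (-r) * r ^ n / n.factorial)) := by
    intro n
    rw [ENNReal.ofReal_mul (by positivity), ENNReal.ofReal_natCast, mul_comm]
  rw [lintegral_countable']
  simp_rw [poissonMeasure_singleton, mul_comm ((_ : ℕ) : ℝ≥0∞), h]
  have hs : HasSum (fun n : ℕ => (n : ℝ) * (Real.exp (-r) * r ^ n / n.factorial)) r := by
    -- The term `n = 0` vanishes, and the term `n + 1` is `r` times the Poisson weight of `n`.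
    rw [← hasSum_nat_add_iff' 1]
    have := (hasSum_one_poissonMeasure r).mul_left (r : ℝ)
    simp only [mul_one] at this
    simp only [Finset.range_one, Finset.sum_singleton, Nat.cast_zero, zero_mul, sub_zero]
    refine this.congr_fun fun n => ?_
    rw [Nat.factorial_succ, pow_succ']
    push_cast
    field_simp
  rw [← ENNReal.ofReal_tsum_of_nonneg (fun n => by positivity) hs.summable, hs.tsum_eq]
  simp

theorem IsPoissonField.lintegral_apply {Ω : Type*} [MeasurableSpace Ω] {P : Measure Ω}
    {Pi : Ω → Measure (ℝ × ℝ)} (h : IsPoissonField P Pi) {B : Set (ℝ × ℝ)} (hB : MeasurableSet B)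
    (hv : volume (B ∩ quadrant) < ∞) : ∫⁻ ω, Pi ω B ∂P = volume (B ∩ quadrant) := by
  have hm : Measurable fun ω => Pi ω B := (Measure.measurable_coe hB).comp h.measurable
  have : ∫⁻ ω, Pi ω B ∂P = ∫⁻ x, x ∂(P.map fun ω => Pi ω B) := by
    rw [lintegral_map (f := fun x => x) measurable_id hm]
  rw [this, h.poisson B hB hv, lintegral_map (f := fun x => x) measurable_id (Measurable.of_discrete),
    lintegral_natCast_poissonMeasure, ENNReal.coe_toNNReal hv.ne]

theorem IsPoissonField.iIndepFun_fintype {Ω : Type*} [MeasurableSpace Ω] {P : Measure Ω}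
    {Pi : Ω → Measure (ℝ × ℝ)} (h : IsPoissonField P Pi) {ι : Type*} [Fintype ι]
    (B : ι → Set (ℝ × ℝ)) (hB : ∀ i, MeasurableSet (B i))
    (hd : Pairwise fun i j => Disjoint (B i) (B j)) : iIndepFun (fun i ω => Pi ω (B i)) P := by
  have e := Fintype.equivFin ι
  have := h.indep (Fintype.card ι) (fun i => B (e.symm i)) (fun i => hB _)
    (fun i j hij => hd (e.symm.injective.ne hij))
  have h2 := this.precomp (g := e) e.injective
  simpa using h2

/-- The σ-algebra generated by the numbers of points in the measurable subsets of `A`. -/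
@[reducible]
def fieldSigma {Ω : Type*} (Pi : Ω → Measure (ℝ × ℝ)) (A : Set (ℝ × ℝ)) : MeasurableSpace Ω :=
  ⨆ C : {C : Set (ℝ × ℝ) // MeasurableSet C ∧ C ⊆ A},
    MeasurableSpace.comap (fun ω => Pi ω C.1) inferInstance

theorem measurable_fieldSigma {Ω : Type*} (Pi : Ω → Measure (ℝ × ℝ)) {A C : Set (ℝ × ℝ)}
    (hC : MeasurableSet C) (h : C ⊆ A) : Measurable[fieldSigma Pi A] fun ω => Pi ω C :=
  Measurable.of_comap_le (le_iSup (fun C : {C : Set (ℝ × ℝ) // MeasurableSet C ∧ C ⊆ A} =>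
    MeasurableSpace.comap (fun ω => Pi ω C.1) inferInstance) ⟨C, hC, h⟩)

/-- The sets `C i` may overlap, while the definition of the field speaks of disjoint sets only. The
atoms `D f` cut out by the `C i` outside `B` are disjoint from each other and from `B`, and the mass
of each `C i` is the sum of the masses of the atoms it contains. -/
theorem IsPoissonField.indepFun_tuple {Ω : Type*} [MeasurableSpace Ω] {P : Measure Ω}
    {Pi : Ω → Measure (ℝ × ℝ)} (h : IsPoissonField P Pi) {B : Set (ℝ × ℝ)}
    (hB : MeasurableSet B) {ι : Type*} [Fintype ι] (C : ι → Set (ℝ × ℝ))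
    (hC : ∀ i, MeasurableSet (C i)) (hd : ∀ i, Disjoint (C i) B) :
    IndepFun (fun ω i => Pi ω (C i)) (fun ω => Pi ω B) P := by
  classical
  let D : (ι → Bool) → Set (ℝ × ℝ) := fun f => Bᶜ ∩ {x | ∀ i, x ∈ C i ↔ f i = true}
  have hD : ∀ f, MeasurableSet (D f) := by
    intro f
    refine hB.compl.inter ?_
    have : {x | ∀ i, x ∈ C i ↔ f i = true} = ⋂ i, {x | x ∈ C i ↔ f i = true} := by
      ext; simp
    rw [this]
    refine MeasurableSet.iInter fun i => ?_
    cases hf : f i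
    · convert (hC i).compl using 1
      ext; simp
    · convert hC i using 1
      ext; simp
  have hDd : ∀ f g, f ≠ g → Disjoint (D f) (D g) := by
    intro f g hfg
    rw [Set.disjoint_left]
    rintro x ⟨-, hx⟩ ⟨-, hy⟩
    apply hfg
    funext i
    have := (hx i).symm.trans (hy i)
    cases hf : f i <;> cases hg : g i <;> simp_all
  let E : Option (ι → Bool) → Set (ℝ × ℝ) := fun o => o.elim B D
  have hE : iIndepFun (fun o ω => Pi ω (E o)) P := by
    refine h.iIndepFun_fintype E ?_ ?_
    · rintro (_ | f)
      exacts [hB, hD f]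
    · rintro (_ | f) (_ | g) hfg
      · exact absurd rfl hfg
      · exact Set.disjoint_left.2 fun x hx hy => hy.1 hx
      · exact Set.disjoint_left.2 fun x hx hy => hx.1 hy
      · exact hDd f g fun h => hfg (by rw [h])
  have hEm : ∀ o, Measurable fun ω => Pi ω (E o) := by
    rintro (_ | f)
    exacts [(Measure.measurable_coe hB).comp h.measurable,
      (Measure.measurable_coe (hD f)).comp h.measurable]
  have key := hE.indepFun_finset (Finset.univ.erase none) {none} (by simp) hEm
  let F : ((Finset.univ.erase (none : Option (ι → Bool)) : Finset _) → ℝ≥0∞) → ι → ℝ≥0∞ :=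
    fun x i => ∑ f : ι → Bool, if f i then x ⟨some f, by simp⟩ else 0
  have hF : Measurable F := by
    refine measurable_pi_lambda _ fun i => Finset.measurable_sum _ fun f _ => ?_
    split_ifs
    · exact measurable_pi_apply _
    · exact measurable_const
  have key2 := key.comp (φ := F) (ψ := fun x => x ⟨none, by simp⟩) hF
    (measurable_pi_apply (X := fun _ => ℝ≥0∞) (⟨none, by simp⟩ : ({none} : Finset (Option (ι → Bool)))))
  suffices hs : (fun ω i => Pi ω (C i)) = F ∘ fun a i => Pi a (E i) by
    rw [hs]
    exact key2
  funext ω i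
  have hU : C i = ⋃ f ∈ (Finset.univ.filter fun f : ι → Bool => f i = true), D f := by
    ext x
    simp only [Finset.mem_filter, Finset.mem_univ, true_and, Set.mem_iUnion, exists_prop, D,
      Set.mem_inter_iff, Set.mem_compl_iff, Set.mem_ofPred_eq]
    constructor
    · intro hx
      exact ⟨fun j => decide (x ∈ C j), by simpa using hx,
        Set.disjoint_left.1 (hd i) hx, fun j => by simp⟩
    · rintro ⟨f, hf, -, hx⟩
      exact (hx i).2 hf
  simp only [Function.comp, F]
  rw [← Finset.sum_filter]
  conv_lhs => rw [hU]
  rw [measure_biUnion_finset (fun f _ g _ hfg => hDd f g hfg) (fun f _ => hD f)]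
  rfl

/-- The σ-algebras generated by finitely many counts form a directed family whose supremum contains
`fieldSigma Pi A`, and independence passes to directed suprema. -/
theorem IsPoissonField.indep_fieldSigma {Ω : Type*} [MeasurableSpace Ω] {P : Measure Ω}
    [IsProbabilityMeasure P]
    {Pi : Ω → Measure (ℝ × ℝ)} (h : IsPoissonField P Pi) {A B : Set (ℝ × ℝ)}
    (hB : MeasurableSet B) (hd : Disjoint A B) :
    Indep (fieldSigma Pi A) (MeasurableSpace.comap (fun ω => Pi ω B) inferInstance) P := by
  classical
  let I := {C : Set (ℝ × ℝ) // MeasurableSet C ∧ C ⊆ A}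
  let m : Finset I → MeasurableSpace Ω := fun T =>
    MeasurableSpace.comap (fun ω (C : T) => Pi ω C.1.1) inferInstance
  have hmeas : ∀ {C}, MeasurableSet C → Measurable fun ω => Pi ω C := fun hC =>
    (Measure.measurable_coe hC).comp h.measurable
  have hcoord : ∀ (T : Finset I) (C : I), C ∈ T → Measurable[m T] fun ω => Pi ω C.1 := by
    intro T C hC
    exact (measurable_pi_apply (X := fun _ : T => ℝ≥0∞) (⟨C, hC⟩ : T)).comp (comap_measurable _)
  have hle : fieldSigma Pi A ≤ ⨆ T, m T := by
    refine iSup_le fun C => ?_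
    refine le_trans ?_ (le_iSup m {C})
    exact (hcoord {C} C (by simp)).comap_le
  refine indep_of_indep_of_le_left (indep_iSup_of_directed_le (m := m) ?_ ?_ ?_ ?_) hle
  · intro T
    exact h.indepFun_tuple hB (fun C : T => C.1.1) (fun C => C.1.2.1)
      (fun C => hd.mono_left C.1.2.2)
  · intro T
    exact (measurable_pi_lambda _ fun C => hmeas C.1.2.1).comap_le
  · exact (hmeas hB).comap_le
  · intro T T'
    refine ⟨T ∪ T', ?_, ?_⟩
    · exact Measurable.comap_le (@measurable_pi_lambda _ _ _ (m (T ∪ T')) _ _ fun C =>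
        hcoord _ _ (Finset.mem_union_left _ C.2))
    · exact Measurable.comap_le (@measurable_pi_lambda _ _ _ (m (T ∪ T')) _ _ fun C =>
        hcoord _ _ (Finset.mem_union_right _ C.2))

/-! ### The history, and the field after a given time -/

/-- The intersections `A ∩ B` with `A` in `m₂` and `B` in `m₃` form a π-system generating `m₂ ⊔ m₃`.
On it the product formula follows by splitting off `B` first and then separating `m₁` from `m₂`. -/
theorem ProbabilityTheory.Indep.sup_of_sup {Ω : Type*} {m₁ m₂ m₃ m₀ : MeasurableSpace Ω}
    {P : Measure Ω} [IsProbabilityMeasure P] (h₁ : m₁ ≤ m₀) (h₂ : m₂ ≤ m₀) (h₃ : m₃ ≤ m₀)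
    (h₁₂ : Indep m₁ m₂ P) (h : Indep (m₁ ⊔ m₂) m₃ P) : Indep m₁ (m₂ ⊔ m₃) P := by
  let p : Set (Set Ω) := {s | ∃ A B, MeasurableSet[m₂] A ∧ MeasurableSet[m₃] B ∧ s = A ∩ B}
  have hgen : m₂ ⊔ m₃ = MeasurableSpace.generateFrom p := by
    apply le_antisymm
    · refine sup_le (fun s hs => ?_) (fun s hs => ?_)
      · exact MeasurableSpace.measurableSet_generateFrom
          ⟨s, Set.univ, hs, MeasurableSet.univ, by simp⟩
      · exact MeasurableSpace.measurableSet_generateFrom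
          ⟨Set.univ, s, MeasurableSet.univ, hs, by simp⟩
    · refine MeasurableSpace.generateFrom_le ?_
      rintro s ⟨A, B, hA, hB, rfl⟩
      exact MeasurableSet.inter (le_sup_left (a := m₂) _ hA) (le_sup_right (a := m₂) _ hB)
  refine IndepSets.indep h₁ (sup_le h₂ h₃) (p1 := {s | MeasurableSet[m₁] s}) (p2 := p)
    (@MeasurableSpace.isPiSystem_measurableSet _ m₁) ?_
    (@MeasurableSpace.generateFrom_measurableSet _ m₁).symm hgen ?_
  · rintro s ⟨A, B, hA, hB, rfl⟩ t ⟨A', B', hA', hB', rfl⟩ -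
    exact ⟨A ∩ A', B ∩ B', hA.inter hA', hB.inter hB', Set.inter_inter_inter_comm _ _ _ _⟩
  · rw [IndepSets_iff]
    rintro s t hs ⟨A, B, hA, hB, rfl⟩
    have hs' : MeasurableSet[m₁] s := hs
    rw [Indep_iff] at h h₁₂
    rw [← Set.inter_assoc, h _ _ (MeasurableSet.inter (le_sup_left (a := m₁) _ hs')
      (le_sup_right (a := m₁) _ hA)) hB, h₁₂ _ _ hs' hA,
      h A B (le_sup_right (a := m₁) _ hA) hB, mul_assoc]

/-- The history of the model up to time `t`: the initial values, all stress releases, and the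
Poisson field up to time `t`. -/
@[reducible]
def history {Ω : Type*} (Pi : Ω → Measure (ℝ × ℝ)) (Z : ℕ → Ω → ℝ) (X₀ Y₀ : Ω → ℝ) (t : ℝ) :
    MeasurableSpace Ω :=
  (fieldSigma Pi {p | p.1 ≤ t} ⊔ MeasurableSpace.comap (fun ω n => Z n ω) inferInstance) ⊔
    MeasurableSpace.comap (fun ω => (X₀ ω, Y₀ ω)) inferInstance

/-- The history up to time `t`, augmented by the null sets. -/
@[reducible]
def augHistory {Ω : Type*} [MeasurableSpace Ω] (P : Measure Ω) (Pi : Ω → Measure (ℝ × ℝ))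
    (Z : ℕ → Ω → ℝ) (X₀ Y₀ : Ω → ℝ) (t : ℝ) : MeasurableSpace Ω :=
  eventuallyMeasurableSpace (history Pi Z X₀ Y₀ t) (ae P)

theorem fieldSigma_mono {Ω : Type*} {Pi : Ω → Measure (ℝ × ℝ)} {A B : Set (ℝ × ℝ)} (h : A ⊆ B) : fieldSigma Pi A ≤ fieldSigma Pi B :=
  iSup_le fun C => (measurable_fieldSigma Pi C.2.1 (C.2.2.trans h)).comap_le

theorem fieldSigma_le_comap {Ω : Type*} {Pi : Ω → Measure (ℝ × ℝ)} (A : Set (ℝ × ℝ)) :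
    fieldSigma Pi A ≤ MeasurableSpace.comap Pi inferInstance :=
  iSup_le fun C => ((Measure.measurable_coe C.2.1).comp (comap_measurable Pi)).comap_le

theorem history_mono {Ω : Type*} {Pi : Ω → Measure (ℝ × ℝ)} {Z : ℕ → Ω → ℝ}
    {X₀ Y₀ : Ω → ℝ} {s t : ℝ} (h : s ≤ t) :
    history Pi Z X₀ Y₀ s ≤ history Pi Z X₀ Y₀ t :=
  sup_le_sup_right (sup_le_sup_right (fieldSigma_mono fun _ hp => le_trans hp h) _) _

section History

variable {Ω : Type*} [MeasurableSpace Ω] {P : Measure Ω} {φ : ℝ → ℝ} {c α k : ℝ}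
  {Pi : Ω → Measure (ℝ × ℝ)} {Z : ℕ → Ω → ℝ} {X₀ Y₀ : Ω → ℝ} {S : Ω → Set ℝ}

theorem history_le_augHistory (t : ℝ) :
    history Pi Z X₀ Y₀ t ≤ augHistory P Pi Z X₀ Y₀ t :=
  le_eventuallyMeasurableSpace

theorem augHistory_mono {s t : ℝ} (h : s ≤ t) :
    augHistory P Pi Z X₀ Y₀ s ≤ augHistory P Pi Z X₀ Y₀ t := by
  rintro A ⟨B, hB, hAB⟩
  exact ⟨B, history_mono h _ hB, hAB⟩

theorem measurableSet_augHistory_congr {t : ℝ} {A B : Set Ω}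
    (hB : MeasurableSet[augHistory P Pi Z X₀ Y₀ t] B) (h : ∀ᵐ ω ∂P, ω ∈ A ↔ ω ∈ B) :
    MeasurableSet[augHistory P Pi Z X₀ Y₀ t] A :=
  EventuallyMeasurableSet.congr hB (eventuallyEq_set.2 h)

/-- The three sources of the history are adjoined one at a time: the field up to `s` by disjointness
from `B`, then `Z`, then the initial values, each independent of everything adjoined before it
together with the mass of `B`. -/
theorem IsEarthquakeModel.indep_history [IsProbabilityMeasure P]
    (h : IsEarthquakeModel P φ c α k Pi Z X₀ Y₀ S) {s : ℝ} {B : Set (ℝ × ℝ)}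
    (hB : MeasurableSet B) (hs : ∀ p ∈ B, s < p.1) :
    Indep (MeasurableSpace.comap (fun ω => Pi ω B) inferInstance) (history Pi Z X₀ Y₀ s) P := by
  have hPi := h.poissonField.measurable
  have hBm : Measurable fun ω => Pi ω B := (Measure.measurable_coe hB).comp hPi
  have hBc : MeasurableSpace.comap (fun ω => Pi ω B) inferInstance ≤
      MeasurableSpace.comap Pi inferInstance :=
    ((Measure.measurable_coe hB).comp (comap_measurable Pi)).comap_le
  have hZ : Measurable fun ω n => Z n ω := measurable_pi_lambda _ h.measurable_Z
  have hF : fieldSigma Pi {p | p.1 ≤ s} ≤ ‹MeasurableSpace Ω› :=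
    (fieldSigma_le_comap _).trans hPi.comap_le
  have h1 : Indep (MeasurableSpace.comap (fun ω => Pi ω B) inferInstance)
      (fieldSigma Pi {p | p.1 ≤ s}) P :=
    (h.poissonField.indep_fieldSigma hB
      (Set.disjoint_left.2 fun p hp hpB => absurd (hs p hpB) (not_lt.2 hp))).symm
  have h2 := h1.sup_of_sup hBm.comap_le hF hZ.comap_le (indep_of_indep_of_le_left
    h.indep_field_Z (sup_le hBc (fieldSigma_le_comap _)))
  refine h2.sup_of_sup hBm.comap_le (sup_le hF hZ.comap_le)
    (h.measurable_X₀.prodMk h.measurable_Y₀).comap_le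
    (indep_of_indep_of_le_left h.indep_init.symm ?_)
  have hcP : MeasurableSpace.comap Pi inferInstance ≤
      MeasurableSpace.comap (fun ω => (Pi ω, fun n => Z n ω)) inferInstance :=
    (measurable_fst.comp (comap_measurable (fun ω => (Pi ω, fun n => Z n ω)))).comap_le
  have hcZ : MeasurableSpace.comap (fun ω n => Z n ω) inferInstance ≤
      MeasurableSpace.comap (fun ω => (Pi ω, fun n => Z n ω)) inferInstance :=
    (measurable_snd.comp (comap_measurable (fun ω => (Pi ω, fun n => Z n ω)))).comap_le
  exact sup_le (hBc.trans hcP) (sup_le ((fieldSigma_le_comap _).trans hcP) hcZ)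

theorem IsEarthquakeModel.setLIntegral_field [IsProbabilityMeasure P]
    (h : IsEarthquakeModel P φ c α k Pi Z X₀ Y₀ S) {s : ℝ} {B : Set (ℝ × ℝ)}
    (hB : MeasurableSet B) (hs : ∀ p ∈ B, s < p.1) (hv : volume (B ∩ quadrant) < ∞)
    {A : Set Ω} (hA : MeasurableSet[augHistory P Pi Z X₀ Y₀ s] A) :
    ∫⁻ ω in A, Pi ω B ∂P = P A * volume (B ∩ quadrant) := by
  obtain ⟨A', hA', hAA'⟩ := hA
  have hBm : Measurable fun ω => Pi ω B :=
    (Measure.measurable_coe hB).comp h.poissonField.measurable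
  have hle : history Pi Z X₀ Y₀ s ≤ ‹MeasurableSpace Ω› :=
    sup_le (sup_le ((fieldSigma_le_comap _).trans h.poissonField.measurable.comap_le)
      (measurable_pi_lambda _ h.measurable_Z).comap_le)
      (h.measurable_X₀.prodMk h.measurable_Y₀).comap_le
  rw [setLIntegral_congr hAA', measure_congr hAA', ← lintegral_indicator (hle _ hA')]
  have e : (A'.indicator fun ω => Pi ω B) =
      fun ω => A'.indicator (fun _ => (1 : ℝ≥0∞)) ω * Pi ω B := by
    funext ω
    by_cases hω : ω ∈ A' <;> simp [hω]
  rw [e, lintegral_mul_eq_lintegral_mul_lintegral_of_independent_measurableSpace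
    hle hBm.comap_le (h.indep_history hB hs).symm (measurable_const.indicator hA')
    (comap_measurable _), h.poissonField.lintegral_apply hB hv,
    lintegral_indicator (hle _ hA')]
  simp

theorem volume_strip_inter_quadrant {s u a : ℝ} (hs : 0 ≤ s) :
    volume ((Set.Ioc s u ×ˢ Set.Iic a) ∩ quadrant) =
      ENNReal.ofReal (u - s) * ENNReal.ofReal a := by
  have : (Set.Ioc s u ×ˢ Set.Iic a) ∩ quadrant = Set.Ioc s u ×ˢ Set.Ioc 0 a := by
    ext p
    simp only [quadrant, Set.mem_inter_iff, Set.mem_prod, Set.mem_Ioc, Set.mem_Iic, Set.mem_Ioi]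
    constructor
    · rintro ⟨⟨h1, h2⟩, h3, h4⟩
      exact ⟨h1, h4, h2⟩
    · rintro ⟨h1, h2, h3⟩
      exact ⟨⟨h1, h3⟩, hs.trans_lt h1.1, h2⟩
  rw [this, Measure.volume_eq_prod, Measure.prod_prod, Real.volume_Ioc, Real.volume_Ioc, sub_zero]

/-- The mean number of points in a strip of random height, when the height takes countably many
values and is known at the beginning of the strip. -/
theorem IsEarthquakeModel.lintegral_strip [IsProbabilityMeasure P]
    (h : IsEarthquakeModel P φ c α k Pi Z X₀ Y₀ S) {s u : ℝ} (hs : 0 ≤ s) {q : ℝ}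
    {J : Ω → ℕ} (hJm : Measurable J) (hJ : Measurable[augHistory P Pi Z X₀ Y₀ s] J) :
    Measurable (fun ω => Pi ω (Set.Ioc s u ×ˢ Set.Iic ((J ω : ℝ) / q))) ∧
    ∫⁻ ω, Pi ω (Set.Ioc s u ×ˢ Set.Iic ((J ω : ℝ) / q)) ∂P =
      ENNReal.ofReal (u - s) * ∫⁻ ω, ENNReal.ofReal ((J ω : ℝ) / q) ∂P := by
  have hst : ∀ j : ℕ, MeasurableSet (Set.Ioc s u ×ˢ Set.Iic ((j : ℝ) / q)) := fun j =>
    measurableSet_Ioc.prod measurableSet_Iic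
  have hm : Measurable (fun p : Ω × ℕ => Pi p.1 (Set.Ioc s u ×ˢ Set.Iic ((p.2 : ℝ) / q))) :=
    measurable_from_prod_countable_left fun j =>
      (Measure.measurable_coe (hst j)).comp h.poissonField.measurable
  have hm1 : Measurable (fun ω => Pi ω (Set.Ioc s u ×ˢ Set.Iic ((J ω : ℝ) / q))) :=
    hm.comp (measurable_id.prodMk hJm)
  refine ⟨hm1, ?_⟩
  have hU : (⋃ j : ℕ, J ⁻¹' {j}) = Set.univ := by ext; simp
  have hd : Pairwise (Function.onFun Disjoint fun j : ℕ => J ⁻¹' {j}) := by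
    intro i j hij
    refine Set.disjoint_left.2 fun ω h1 h2 => hij ?_
    simp only [Set.mem_preimage, Set.mem_singleton_iff] at h1 h2
    rw [← h1, ← h2]
  have hms : ∀ j, MeasurableSet (J ⁻¹' {j}) := fun j => hJm (measurableSet_singleton j)
  rw [← setLIntegral_univ, ← setLIntegral_univ (fun ω => ENNReal.ofReal ((J ω : ℝ) / q)), ← hU,
    lintegral_iUnion hms hd, lintegral_iUnion hms hd, ← ENNReal.tsum_mul_left]
  congr 1
  funext j
  have e1 : ∫⁻ ω in J ⁻¹' {j}, Pi ω (Set.Ioc s u ×ˢ Set.Iic ((J ω : ℝ) / q)) ∂P =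
      ∫⁻ ω in J ⁻¹' {j}, Pi ω (Set.Ioc s u ×ˢ Set.Iic ((j : ℝ) / q)) ∂P :=
    setLIntegral_congr_fun (hms j) fun ω hω => by
      rw [Set.mem_preimage, Set.mem_singleton_iff] at hω
      simp only [hω]
  have e2 : ∫⁻ ω in J ⁻¹' {j}, ENNReal.ofReal ((J ω : ℝ) / q) ∂P =
      ∫⁻ ω in J ⁻¹' {j}, ENNReal.ofReal ((j : ℝ) / q) ∂P :=
    setLIntegral_congr_fun (hms j) fun ω hω => by
      rw [Set.mem_preimage, Set.mem_singleton_iff] at hω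
      simp only [hω]
  rw [e1, e2, h.setLIntegral_field (hst j) (fun p hp => hp.1.1) ?_
    (hJ (measurableSet_singleton j)), volume_strip_inter_quadrant hs, setLIntegral_const]
  · ring
  · rw [volume_strip_inter_quadrant hs]
    exact ENNReal.mul_lt_top ENNReal.ofReal_lt_top ENNReal.ofReal_lt_top

end History

/-! ### Enumeration of the shocks of one realization -/

section Counting

variable {S : Set ℝ}

theorem shockCount_mono (hS : ∀ t, (S ∩ Set.Ioc 0 t).Finite) : Monotone (shockCount S) :=
  fun _ t hst => Set.ncard_le_ncard
    (Set.inter_subset_inter_right _ (Set.Ioc_subset_Ioc_right hst)) (hS t)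

theorem shockCount_zero : shockCount S 0 = 0 := by simp [shockCount]

/-- The time of the `(j+1)`-st shock when it occurs up to time `t`, and `t` otherwise. -/
noncomputable def shockTime (S : Set ℝ) (hS : ∀ t, (S ∩ Set.Ioc 0 t).Finite) (t : ℝ) (j : ℕ) : ℝ :=
  if h : j < (hS t).toFinset.card then (hS t).toFinset.orderEmbOfFin rfl ⟨j, h⟩ else t

theorem card_toFinset_shocks (hS : ∀ t, (S ∩ Set.Ioc 0 t).Finite) (t : ℝ) :
    (hS t).toFinset.card = shockCount S t :=
  (Set.ncard_eq_toFinset_card _ (hS t)).symm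

theorem shockTime_of_lt (hS : ∀ t, (S ∩ Set.Ioc 0 t).Finite) {t : ℝ} {j : ℕ}
    (h : j < (hS t).toFinset.card) :
    shockTime S hS t j = (hS t).toFinset.orderEmbOfFin rfl ⟨j, h⟩ := by
  rw [shockTime, dif_pos h]

theorem shockTime_of_le (hS : ∀ t, (S ∩ Set.Ioc 0 t).Finite) {t : ℝ} {j : ℕ}
    (h : shockCount S t ≤ j) : shockTime S hS t j = t := by
  rw [shockTime, dif_neg]
  rw [card_toFinset_shocks]
  exact not_lt.2 h

theorem shockTime_mem (hS : ∀ t, (S ∩ Set.Ioc 0 t).Finite) {t : ℝ} {j : ℕ}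
    (h : j < shockCount S t) : shockTime S hS t j ∈ S ∩ Set.Ioc 0 t := by
  rw [← card_toFinset_shocks hS] at h
  rw [shockTime_of_lt hS h]
  exact (hS t).mem_toFinset.1 (Finset.orderEmbOfFin_mem _ _ _)

theorem shockTime_le (hS : ∀ t, (S ∩ Set.Ioc 0 t).Finite) (t : ℝ) (j : ℕ) :
    shockTime S hS t j ≤ t := by
  rcases lt_or_ge j (shockCount S t) with h | h
  · exact (shockTime_mem hS h).2.2
  · exact (shockTime_of_le hS h).le

theorem shockTime_nonneg (hS : ∀ t, (S ∩ Set.Ioc 0 t).Finite) {t : ℝ} (ht : 0 ≤ t) (j : ℕ) :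
    0 ≤ shockTime S hS t j := by
  rcases lt_or_ge j (shockCount S t) with h | h
  · exact (shockTime_mem hS h).2.1.le
  · rwa [shockTime_of_le hS h]

theorem shockTime_lt_shockTime (hS : ∀ t, (S ∩ Set.Ioc 0 t).Finite) {t : ℝ} {i j : ℕ}
    (hij : i < j) (h : j < shockCount S t) : shockTime S hS t i < shockTime S hS t j := by
  rw [← card_toFinset_shocks hS] at h
  rw [shockTime_of_lt hS h, shockTime_of_lt hS (hij.trans h)]
  exact ((hS t).toFinset.orderEmbOfFin rfl).strictMono hij

/-- The shocks up to `r` are an initial segment of the increasing enumeration of those up to `t`. -/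
theorem shockTime_le_iff_of_lt (hS : ∀ t, (S ∩ Set.Ioc 0 t).Finite) {t r : ℝ} {j : ℕ}
    (hrt : r ≤ t) (hj : j < shockCount S t) : shockTime S hS t j ≤ r ↔ j < shockCount S r := by
  classical
  set F := (hS t).toFinset with hF
  have hcard : F.card = shockCount S t := card_toFinset_shocks hS t
  have hr : shockCount S r = (Finset.univ.filter fun i : Fin F.card =>
      F.orderEmbOfFin rfl i ≤ r).card := by
    rw [← card_toFinset_shocks hS, ← Finset.card_map (F.orderEmbOfFin rfl).toEmbedding]
    congr 1
    ext x
    simp only [Set.Finite.mem_toFinset, Finset.mem_map, Finset.mem_filter, Finset.mem_univ,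
      true_and, RelEmbedding.coe_toEmbedding]
    constructor
    · rintro ⟨hx, hx0, hxr⟩
      have : x ∈ Set.range (F.orderEmbOfFin rfl) := by
        rw [Finset.range_orderEmbOfFin]
        simpa [hF] using ⟨hx, hx0, hxr.trans hrt⟩
      obtain ⟨i, rfl⟩ := this
      exact ⟨i, hxr, rfl⟩
    · rintro ⟨i, hi, rfl⟩
      have := (hS t).mem_toFinset.1 (Finset.orderEmbOfFin_mem F rfl i)
      exact ⟨this.1, this.2.1, hi⟩
  have hj' : j < F.card := by rwa [hcard]
  rw [shockTime_of_lt hS hj', hr]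
  constructor
  · intro h
    have : (Finset.Iic (⟨j, hj'⟩ : Fin F.card)) ⊆
        Finset.univ.filter fun i : Fin F.card => F.orderEmbOfFin rfl i ≤ r := by
      intro i hi
      rw [Finset.mem_Iic] at hi
      simp only [Finset.mem_filter, Finset.mem_univ, true_and]
      exact ((F.orderEmbOfFin rfl).monotone hi).trans h
    have := Finset.card_le_card this
    rw [Fin.card_Iic] at this
    exact this
  · intro h
    by_contra hlt
    push Not at hlt
    have : (Finset.univ.filter fun i : Fin F.card => F.orderEmbOfFin rfl i ≤ r) ⊆
        Finset.Iio (⟨j, hj'⟩ : Fin F.card) := by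
      intro i hi
      simp only [Finset.mem_filter, Finset.mem_univ, true_and] at hi
      rw [Finset.mem_Iio]
      exact (F.orderEmbOfFin rfl).lt_iff_lt.1 (hi.trans_lt hlt)
    have := Finset.card_le_card this
    rw [Fin.card_Iio] at this
    exact absurd h (not_lt.2 this)

/-- The strict inequality `r < t` allows for an index `j` with no shock, for which `shockTime` takes
the default value `t`. -/
theorem shockTime_le_iff (hS : ∀ t, (S ∩ Set.Ioc 0 t).Finite) {t r : ℝ} {j : ℕ}
    (hrt : r < t) : shockTime S hS t j ≤ r ↔ j < shockCount S r := by
  rcases lt_or_ge j (shockCount S t) with h | h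
  · exact shockTime_le_iff_of_lt hS hrt.le h
  · rw [shockTime_of_le hS h]
    exact ⟨fun h' => absurd hrt (not_lt.2 h'),
      fun h' => absurd (h.trans_lt h') (not_lt.2 (shockCount_mono hS hrt.le))⟩

theorem finsum_shocks_eq (hS : ∀ t, (S ∩ Set.Ioc 0 t).Finite) {t u : ℝ} (hut : u ≤ t)
    (g : ℝ → ℝ) : ∑ᶠ s ∈ S ∩ Set.Ioc 0 u, g s =
      ∑ j ∈ Finset.range (shockCount S u), g (shockTime S hS t j) := by
  classical
  have hle := shockCount_mono hS hut
  have himg : (hS u).toFinset = (Finset.range (shockCount S u)).image (shockTime S hS t) := by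
    symm
    apply Finset.eq_of_subset_of_card_le
    · intro x hx
      obtain ⟨j, hj, rfl⟩ := Finset.mem_image.1 hx
      rw [Finset.mem_range] at hj
      have h1 := shockTime_mem hS (hj.trans_le hle)
      rw [Set.Finite.mem_toFinset]
      exact ⟨h1.1, h1.2.1, (shockTime_le_iff_of_lt hS hut (hj.trans_le hle)).2 hj⟩
    · rw [card_toFinset_shocks, Finset.card_image_of_injOn, Finset.card_range]
      intro i hi j hj hij
      simp only [Finset.coe_range, Set.mem_Iio] at hi hj
      rcases lt_trichotomy i j with h | h | h
      · exact absurd hij (shockTime_lt_shockTime hS h (hj.trans_le hle)).ne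
      · exact h
      · exact absurd hij (shockTime_lt_shockTime hS h (hi.trans_le hle)).ne'
  rw [finsum_mem_eq_finite_toFinset_sum _ (hS u), himg, Finset.sum_image]
  intro i hi j hj hij
  simp only [Finset.coe_range, Set.mem_Iio] at hi hj
  rcases lt_trichotomy i j with h | h | h
  · exact absurd hij (shockTime_lt_shockTime hS h (hj.trans_le hle)).ne
  · exact h
  · exact absurd hij (shockTime_lt_shockTime hS h (hi.trans_le hle)).ne'

theorem shocks_eq_of_count_eq (hS : ∀ t, (S ∩ Set.Ioc 0 t).Finite) {a u : ℝ} (hau : a ≤ u)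
    (h : shockCount S u = shockCount S a) : S ∩ Set.Ioc 0 u = S ∩ Set.Ioc 0 a :=
  (Set.eq_of_subset_of_ncard_le
    (Set.inter_subset_inter_right _ (Set.Ioc_subset_Ioc_right hau)) h.le (hS u)).symm

theorem exists_left_const_shocks (hS : ∀ t, (S ∩ Set.Ioc 0 t).Finite) (s : ℝ) (hs : 0 < s) :
    ∃ a, 0 ≤ a ∧ a < s ∧ ∀ u ∈ Set.Ico a s, S ∩ Set.Ioc 0 u = S ∩ Set.Ioc 0 a := by
  have hf : (S ∩ Set.Ioo 0 s).Finite := (hS s).subset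
    (Set.inter_subset_inter_right _ Set.Ioo_subset_Ioc_self)
  -- The point `a` is the last shock strictly before `s`, or `0` if there is none.
  obtain ⟨a, ha⟩ : ∃ a, IsGreatest (insert 0 (S ∩ Set.Ioo 0 s)) a :=
    (hf.insert 0).isCompact.exists_isGreatest (Set.insert_nonempty _ _)
  refine ⟨a, ha.2 (Set.mem_insert _ _), ?_, ?_⟩
  · rcases ha.1 with h | h
    · rwa [h]
    · exact h.2.2
  · intro u hu
    refine Set.Subset.antisymm ?_ (Set.inter_subset_inter_right _ (Set.Ioc_subset_Ioc_right hu.1))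
    rintro x ⟨hx, hx0, hxu⟩
    exact ⟨hx, hx0, ha.2 (Set.mem_insert_of_mem _ ⟨hx, hx0, hxu.trans_lt hu.2⟩)⟩

end Counting

/-! ### Left limits of the intensity and adaptedness of the shocks -/

/-- Between shocks the stress increases strictly, as `c > 0`, so it approaches its left limit from
below. Hence `φ`, which may jump, enters through `leftLim φ`; the aftershock part is continuous
there. -/
theorem tendsto_totalIntensity_left {Ω : Type*} {φ : ℝ → ℝ} {c : ℝ} (α k : ℝ)
    (Z : ℕ → Ω → ℝ) (X₀ Y₀ : Ω → ℝ) {S : Ω → Set ℝ} (hφ : Monotone φ) (hc : 0 < c) {ω : Ω}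
    (hS : ∀ t, (S ω ∩ Set.Ioc 0 t).Finite) {a s : ℝ} (has : a < s)
    (hconst : ∀ u ∈ Set.Ico a s, S ω ∩ Set.Ioc 0 u = S ω ∩ Set.Ioc 0 a) :
    Tendsto (fun u => totalIntensity φ c α k Z X₀ Y₀ S u ω) (𝓝[<] s)
      (𝓝 (Function.leftLim φ
          (X₀ ω + c * s - ∑ n ∈ Finset.range (shockCount (S ω) a), Z n ω) +
        (Y₀ ω * Real.exp (-α * s) +
          k * ∑ᶠ r ∈ S ω ∩ Set.Ioc 0 a, Real.exp (-α * (s - r))))) := by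
  have hev : (fun u => φ (X₀ ω + c * u - ∑ n ∈ Finset.range (shockCount (S ω) a), Z n ω) +
        (Y₀ ω * Real.exp (-α * u) + k * ∑ᶠ r ∈ S ω ∩ Set.Ioc 0 a, Real.exp (-α * (u - r))))
      =ᶠ[𝓝[<] s] fun u => totalIntensity φ c α k Z X₀ Y₀ S u ω := by
    filter_upwards [Ico_mem_nhdsLT has] with u hu
    simp only [totalIntensity, primaryIntensity, secondaryIntensity, stress, shockCount,
      hconst u hu]
  refine Tendsto.congr' hev (Tendsto.add ?_ ?_)
  · refine (hφ.tendsto_leftLim _).comp (tendsto_nhdsWithin_iff.2 ⟨?_, ?_⟩)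
    · refine Tendsto.mono_left ?_ nhdsWithin_le_nhds
      exact Continuous.tendsto (by fun_prop) s
    · filter_upwards [self_mem_nhdsWithin] with u hu
      have : c * u < c * s := mul_lt_mul_of_pos_left hu hc
      simp only [Set.mem_Iio]
      linarith
  · refine Tendsto.mono_left ?_ nhdsWithin_le_nhds
    simp only [finsum_mem_eq_finite_toFinset_sum _ (hS a)]
    exact Continuous.tendsto (by fun_prop) s

/-- The mass that a random measure gives to a measurable random set is measurable, up to the event
that the measure is not locally finite. -/
theorem exists_measurable_section {Ω : Type*} [MeasurableSpace Ω] {Pi : Ω → Measure (ℝ × ℝ)}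
    {t : ℝ} (hPi : ∀ C, MeasurableSet C → C ⊆ {p : ℝ × ℝ | p.1 ≤ t} → Measurable fun ω => Pi ω C)
    {A : Set (Ω × ℝ × ℝ)} (hA : MeasurableSet A) (hsub : ∀ q ∈ A, q.2.1 ∈ Set.Ioc 0 t) :
    ∃ f : Ω → ℝ≥0∞, Measurable f ∧
      ∀ ω, (∀ K : ℕ, Pi ω (Set.Ioc 0 t ×ˢ Set.Iic (K : ℝ)) < ∞) →
        Pi ω (Prod.mk ω ⁻¹' A) = f ω := by
  classical
  let B : ℕ → Set (ℝ × ℝ) := fun K => Set.Ioc 0 t ×ˢ Set.Iic (K : ℝ)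
  have hB : ∀ K, MeasurableSet (B K) := fun K => measurableSet_Ioc.prod measurableSet_Iic
  have hBt : ∀ K, B K ⊆ {p : ℝ × ℝ | p.1 ≤ t} := fun K p hp => hp.1.2
  -- Measurability of sections is available for kernels with finite measures, so the field is cut
  -- off at height `K` and replaced by `0` where the cut-off is infinite. The heights are then
  -- exhausted by a supremum.
  let κ : ℕ → Kernel Ω (ℝ × ℝ) := fun K =>
    ⟨fun ω => if Pi ω (B K) < ∞ then (Pi ω).restrict (B K) else 0, by
      refine Measurable.ite (measurableSet_lt (hPi _ (hB K) (hBt K)) measurable_const) ?_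
        measurable_const
      refine Measure.measurable_of_measurable_coe _ fun C hC => ?_
      simp only [Measure.restrict_apply hC]
      exact hPi _ (hC.inter (hB K)) (Set.inter_subset_right.trans (hBt K))⟩
  have hκ : ∀ K ω, κ K ω = if Pi ω (B K) < ∞ then (Pi ω).restrict (B K) else 0 := fun _ _ => rfl
  have hfin : ∀ K ω, IsFiniteMeasure (κ K ω) := by
    intro K ω
    rw [hκ]
    split_ifs with h
    · exact ⟨by rwa [Measure.restrict_apply_univ]⟩
    · infer_instance
  refine ⟨fun ω => ⨆ K, κ K ω (Prod.mk ω ⁻¹' A), Measurable.iSup fun K =>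
    Kernel.measurable_kernel_prodMk_left_of_finite hA (hfin K), fun ω hω => ?_⟩
  have hAω : MeasurableSet (Prod.mk ω ⁻¹' A) := measurable_prodMk_left hA
  have hU : Prod.mk ω ⁻¹' A = ⋃ K, Prod.mk ω ⁻¹' A ∩ B K := by
    rw [← Set.inter_iUnion]
    symm
    rw [Set.inter_eq_left]
    intro p hp
    obtain ⟨K, hK⟩ := exists_nat_ge p.2
    exact Set.mem_iUnion.2 ⟨K, hsub _ hp, hK⟩
  conv_lhs => rw [hU]
  rw [Monotone.measure_iUnion]
  · congr 1
    funext K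
    rw [hκ, if_pos (hω K), Measure.restrict_apply hAω]
  · intro K L hKL
    refine Set.inter_subset_inter_right _ (Set.prod_mono_right (Set.Iic_subset_Iic.2 ?_))
    exact_mod_cast hKL

theorem measurableSet_region {Ω : Type*} [MeasurableSpace Ω] {σ X₀ Y₀ W : Ω → ℝ} {n : ℕ}
    {τ : ℕ → Ω → ℝ} {ψ : ℝ → ℝ} (c α k t : ℝ) (hψ : Measurable ψ) (hσ : Measurable σ)
    (hX : Measurable X₀) (hY : Measurable Y₀) (hW : Measurable W)
    (hτ : ∀ j < n, Measurable (τ j)) :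
    MeasurableSet {q : Ω × ℝ × ℝ | σ q.1 < q.2.1 ∧ q.2.1 ≤ t ∧
      q.2.2 ≤ ψ (X₀ q.1 + c * q.2.1 - W q.1) + (Y₀ q.1 * Real.exp (-α * q.2.1) +
        k * ∑ j ∈ Finset.range n, Real.exp (-α * (q.2.1 - τ j q.1)))} := by
  have hs : Measurable fun q : Ω × ℝ × ℝ => q.2.1 := measurable_fst.comp measurable_snd
  have hz : Measurable fun q : Ω × ℝ × ℝ => q.2.2 := measurable_snd.comp measurable_snd
  have h1 : Measurable fun q : Ω × ℝ × ℝ => q.1 := measurable_fst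
  refine (measurableSet_lt (hσ.comp h1) hs).inter
    ((measurableSet_le hs measurable_const).inter (measurableSet_le hz ?_))
  refine (hψ.comp (((hX.comp h1).add (hs.const_mul c)).sub (hW.comp h1))).add
    (((hY.comp h1).mul (Real.measurable_exp.comp (hs.const_mul _))).add
      (Measurable.const_mul (Finset.measurable_sum _ fun j hj => ?_) _))
  exact Real.measurable_exp.comp
    ((hs.sub ((hτ j (Finset.mem_range.1 hj)).comp h1)).const_mul _)

theorem measurable_sum_range {Ω : Type*} [MeasurableSpace Ω] {g : ℕ → Ω → ℝ} {N : Ω → ℕ}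
    (hg : ∀ j, Measurable (g j)) (hN : Measurable N) :
    Measurable fun ω => ∑ j ∈ Finset.range (N ω), g j ω := by
  have : Measurable fun p : Ω × ℕ => ∑ j ∈ Finset.range p.2, g j p.1 :=
    measurable_from_prod_countable_left fun n =>
      Finset.measurable_sum (Finset.range n) fun j _ => hg j
  exact this.comp (measurable_id.prodMk hN)

theorem measurable_intensity_formula {Ω : Type*} [MeasurableSpace Ω] {X₀ Y₀ : Ω → ℝ}
    {Z τ : ℕ → Ω → ℝ} {N : Ω → ℕ} {φ : ℝ → ℝ} (c α k t : ℝ) (hφ : Measurable φ)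
    (hX : Measurable X₀) (hY : Measurable Y₀) (hZ : ∀ j, Measurable (Z j))
    (hτ : ∀ j, Measurable (τ j)) (hN : Measurable N) :
    Measurable fun ω => φ (X₀ ω + c * t - ∑ n ∈ Finset.range (N ω), Z n ω) +
      (Y₀ ω * Real.exp (-α * t) +
        k * ∑ j ∈ Finset.range (N ω), Real.exp (-α * (t - τ j ω))) := by
  refine (hφ.comp ((hX.add_const _).sub (measurable_sum_range hZ hN))).add
    ((hY.mul_const _).add ((measurable_sum_range (fun j => ?_) hN).const_mul k))
  exact Real.measurable_exp.comp (((hτ j).const_sub t).const_mul _)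

/-- The points of the field below the left limits of the intensity. -/
noncomputable def acceptedRegion (f : ℝ → ℝ) (t : ℝ) : Set (ℝ × ℝ) :=
  {p : ℝ × ℝ | 0 < p.1 ∧ p.1 ≤ t ∧ p.2 ≤ Function.leftLim f p.1}

theorem acceptedRegion_add_diff {μ : Measure (ℝ × ℝ)} {f : ℝ → ℝ} {a t : ℝ} (ha : 0 ≤ a)
    (hat : a ≤ t) : μ (acceptedRegion f a) +
      μ {p : ℝ × ℝ | a < p.1 ∧ p.1 ≤ t ∧ p.2 ≤ Function.leftLim f p.1} =
      μ (acceptedRegion f t) := by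
  have hm : MeasurableSet {p : ℝ × ℝ | p.1 ≤ a} := measurableSet_le measurable_fst measurable_const
  rw [← measure_inter_add_sdiff (acceptedRegion f t) hm]
  congr 2
  · ext p
    simp only [acceptedRegion, Set.mem_ofPred_eq, Set.mem_inter_iff]
    constructor
    · rintro ⟨h1, h2, h3⟩
      exact ⟨⟨h1, h2.trans hat, h3⟩, h2⟩
    · rintro ⟨⟨h1, h2, h3⟩, h4⟩
      exact ⟨h1, h4, h3⟩
  · ext p
    simp only [acceptedRegion, Set.mem_ofPred_eq, Set.mem_sdiff, not_le]
    constructor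
    · rintro ⟨h1, h2, h3⟩
      exact ⟨⟨ha.trans_lt h1, h2, h3⟩, h1⟩
    · rintro ⟨⟨h1, h2, h3⟩, h4⟩
      exact ⟨h4, h2, h3⟩

/-- A shock after the `n`-th one occurs up to time `t` if and only if the field charges the region
below the intensity computed from the first `n` shocks. -/
theorem lt_shockCount_iff_field_pos {Ω : Type*} {φ : ℝ → ℝ} {c α k : ℝ}
    {Pi : Ω → Measure (ℝ × ℝ)} {Z : ℕ → Ω → ℝ} {X₀ Y₀ : Ω → ℝ} {S : Ω → Set ℝ} {ω : Ω} (hφ : Monotone φ) (hc : 0 < c)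
    (hS : ∀ t, (S ω ∩ Set.Ioc 0 t).Finite)
    (hthin : ∀ t : ℝ, 0 ≤ t → (shockCount (S ω) t : ℝ≥0∞) =
      Pi ω (acceptedRegion (fun u => totalIntensity φ c α k Z X₀ Y₀ S u ω) t))
    {t : ℝ} (ht : 0 ≤ t) (n : ℕ) {σ : ℝ}
    (hσ : σ = if n = 0 then 0 else shockTime (S ω) hS t (n - 1)) :
    n < shockCount (S ω) t ↔
    0 < Pi ω {p : ℝ × ℝ | σ < p.1 ∧ p.1 ≤ t ∧
      p.2 ≤ Function.leftLim φ (X₀ ω + c * p.1 - ∑ j ∈ Finset.range n, Z j ω) +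
        (Y₀ ω * Real.exp (-α * p.1) +
          k * ∑ j ∈ Finset.range n, Real.exp (-α * (p.1 - shockTime (S ω) hS t j)))} := by
  set f : ℝ → ℝ := fun u => totalIntensity φ c α k Z X₀ Y₀ S u ω with hf
  set T := shockTime (S ω) hS t n with hT
  set A := {p : ℝ × ℝ | σ < p.1 ∧ p.1 ≤ t ∧
      p.2 ≤ Function.leftLim φ (X₀ ω + c * p.1 - ∑ j ∈ Finset.range n, Z j ω) +
        (Y₀ ω * Real.exp (-α * p.1) +
          k * ∑ j ∈ Finset.range n, Real.exp (-α * (p.1 - shockTime (S ω) hS t j)))} with hA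
  have hTt : T ≤ t := shockTime_le hS t n
  have hσ0 : 0 ≤ σ := by
    rw [hσ]; split_ifs
    exacts [le_rfl, shockTime_nonneg hS ht _]
  have hσt : σ ≤ t := by
    rw [hσ]; split_ifs
    exacts [ht, shockTime_le hS t _]
  -- Here `σ` is the time of the `n`-th shock, which has index `n - 1`. With fewer than `n` shocks
  -- up to `t` it is `t`, and the claim is void.
  have hcount : ∀ u, σ ≤ u → u < t → n ≤ shockCount (S ω) u := by
    intro u hu hut
    rw [hσ] at hu
    split_ifs at hu with h0
    · omega
    · have := (shockTime_le_iff hS hut).1 hu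
      omega
  have hcount' : ∀ u, u < T → shockCount (S ω) u ≤ n := by
    intro u hu
    by_contra hlt
    push Not at hlt
    exact absurd ((shockTime_le_iff hS (hu.trans_le hTt)).2 hlt) (not_le.2 hu)
  have hconst : ∀ u ∈ Set.Ico σ T, shockCount (S ω) u = n := fun u hu =>
    le_antisymm (hcount' u hu.2) (hcount u hu.1 (hu.2.trans_le hTt))
  -- Exactly `n` shocks have occurred throughout `[σ, T)`, so up to and including `T` the left limit
  -- of the true intensity is the curve computed from the first `n` shocks. Beyond `T` the two may
  -- differ.
  have hleft : ∀ s, σ < s → s ≤ T → Function.leftLim f s =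
      Function.leftLim φ (X₀ ω + c * s - ∑ j ∈ Finset.range n, Z j ω) +
        (Y₀ ω * Real.exp (-α * s) +
          k * ∑ j ∈ Finset.range n, Real.exp (-α * (s - shockTime (S ω) hS t j))) := by
    intro s h1 h2
    have hσn : shockCount (S ω) σ = n := hconst σ ⟨le_rfl, h1.trans_le h2⟩
    have := tendsto_totalIntensity_left α k Z X₀ Y₀ hφ hc hS h1 fun u hu =>
      shocks_eq_of_count_eq hS hu.1 ((hconst u ⟨hu.1, hu.2.trans_le h2⟩).trans hσn.symm)
    rw [hσn, finsum_shocks_eq hS hσt fun r => Real.exp (-α * (s - r)), hσn] at this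
    exact leftLim_eq_of_tendsto this
  have hregion : {p : ℝ × ℝ | σ < p.1 ∧ p.1 ≤ T ∧ p.2 ≤ Function.leftLim f p.1} ⊆ A := by
    rintro p ⟨h1, h2, h3⟩
    exact ⟨h1, h2.trans hTt, by rwa [← hleft p.1 h1 h2]⟩
  constructor
  · intro hn
    have hσT : σ < T := by
      rw [hσ]; split_ifs with h0
      · exact (shockTime_mem hS hn).2.1
      · exact shockTime_lt_shockTime hS (by omega) hn
    have hNT : n < shockCount (S ω) T := (shockTime_le_iff_of_lt hS hTt hn).1 le_rfl
    have hNσ := hconst σ ⟨le_rfl, hσT⟩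
    -- By the thinning equation the region between `σ` and `T` has mass `N(T) - N(σ)`, which is
    -- positive because the next shock is at `T`.
    have hadd := acceptedRegion_add_diff (μ := Pi ω) (f := f) hσ0 hσT.le
    rw [← hthin σ hσ0, ← hthin T (hσ0.trans hσT.le), hNσ] at hadd
    refine lt_of_lt_of_le (pos_iff_ne_zero.2 fun h0 => ?_) (measure_mono hregion)
    rw [h0, add_zero] at hadd
    exact absurd (Nat.cast_injective hadd) hNT.ne
  · intro hpos
    by_contra hn
    push Not at hn
    -- Without a further shock the default value gives `T = t`. The curve and the true left limits
    -- then agree on all of `(σ, t]`, where the count does not grow.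
    have hTeq : T = t := shockTime_of_le hS hn
    rcases hσt.eq_or_lt with h | h
    · have : A = ∅ := by
        ext p
        simp only [hA, Set.mem_ofPred_eq, Set.mem_empty_iff_false, iff_false]
        rintro ⟨h1, h2, -⟩
        linarith
      rw [this, measure_empty] at hpos
      exact lt_irrefl _ hpos
    · have hNσ := hconst σ ⟨le_rfl, by rwa [hTeq]⟩
      have hNt : shockCount (S ω) t = n :=
        le_antisymm hn (hNσ ▸ shockCount_mono hS hσt)
      have hadd := acceptedRegion_add_diff (μ := Pi ω) (f := f) hσ0 hσt
      rw [← hthin σ hσ0, ← hthin t ht, hNσ, hNt] at hadd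
      have hzero : Pi ω {p : ℝ × ℝ | σ < p.1 ∧ p.1 ≤ t ∧ p.2 ≤ Function.leftLim f p.1} = 0 := by
        have : (n : ℝ≥0∞) + Pi ω _ = n + 0 := hadd.trans (add_zero _).symm
        exact (ENNReal.add_right_inj (ENNReal.natCast_ne_top n)).1 this
      have hAe : A ⊆ {p : ℝ × ℝ | σ < p.1 ∧ p.1 ≤ t ∧ p.2 ≤ Function.leftLim f p.1} := by
        rintro p ⟨h1, h2, h3⟩
        exact ⟨h1, h2, by rwa [hleft p.1 h1 (by rwa [hTeq])]⟩
      exact absurd (measure_mono_null hAe hzero) hpos.ne'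

section Adapted

variable {Ω : Type*} [MeasurableSpace Ω] {P : Measure Ω} {φ : ℝ → ℝ} {c α k : ℝ}
  {Pi : Ω → Measure (ℝ × ℝ)} {Z : ℕ → Ω → ℝ} {X₀ Y₀ : Ω → ℝ} {S : Ω → Set ℝ}

theorem IsPoissonField.ae_locallyFinite (h : IsPoissonField P Pi) :
    ∀ᵐ ω ∂P, ∀ t K : ℝ, Pi ω (Set.Ioc 0 t ×ˢ Set.Iic K) < ∞ := by
  have h1 : ∀ᵐ ω ∂P, ∀ m K : ℕ, Pi ω (Set.Ioc 0 (m : ℝ) ×ˢ Set.Iic (K : ℝ)) < ∞ := by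
    rw [ae_all_iff]
    intro m
    rw [ae_all_iff]
    intro K
    have hm : MeasurableSet (Set.Ioc 0 (m : ℝ) ×ˢ Set.Iic (K : ℝ)) :=
      measurableSet_Ioc.prod measurableSet_Iic
    have hv : volume ((Set.Ioc 0 (m : ℝ) ×ˢ Set.Iic (K : ℝ)) ∩ quadrant) < ∞ := by
      rw [volume_strip_inter_quadrant le_rfl]
      exact ENNReal.mul_lt_top ENNReal.ofReal_lt_top ENNReal.ofReal_lt_top
    refine ae_lt_top ((Measure.measurable_coe hm).comp h.measurable) ?_
    change ∫⁻ ω, Pi ω _ ∂P ≠ ∞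
    rw [h.lintegral_apply hm hv]
    exact hv.ne
  filter_upwards [h1] with ω hω t K
  obtain ⟨m, hm⟩ := exists_nat_ge t
  obtain ⟨L, hL⟩ := exists_nat_ge K
  exact (measure_mono (Set.prod_mono (Set.Ioc_subset_Ioc_right hm) (Set.Iic_subset_Iic.2 hL))).trans_lt
    (hω m L)

theorem measurable_shockTime_augHistory (hS : ∀ ω t, (S ω ∩ Set.Ioc 0 t).Finite) {j : ℕ}
    (hj : ∀ r, MeasurableSet[augHistory P Pi Z X₀ Y₀ r] {ω | j < shockCount (S ω) r}) (t : ℝ) :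
    Measurable[augHistory P Pi Z X₀ Y₀ t] fun ω => shockTime (S ω) (hS ω) t j := by
  refine @measurable_of_Iic _ _ _ _ _ (augHistory P Pi Z X₀ Y₀ t) _ _ _ _ fun r => ?_
  rcases lt_or_ge r t with h | h
  · convert augHistory_mono h.le _ (hj r) using 1
    ext ω
    exact shockTime_le_iff (hS ω) h
  · convert MeasurableSet.univ using 1
    ext ω
    simpa using (shockTime_le (hS ω) t j).trans h

/-- Strong induction on `n`: the first `n` shock times are measurable for the history by the
induction hypothesis, hence so is the region below the curve they define, and the event says that
the field charges this region. -/
theorem IsEarthquakeModel.measurableSet_lt_shockCount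
    (h : IsEarthquakeModel P φ c α k Pi Z X₀ Y₀ S) (n : ℕ) (t : ℝ) :
    MeasurableSet[augHistory P Pi Z X₀ Y₀ t] {ω | n < shockCount (S ω) t} := by
  induction n using Nat.strong_induction_on generalizing t with
  | _ n ih =>
  rcases lt_or_ge t 0 with ht | ht
  · convert MeasurableSet.empty using 1
    ext ω
    simp [shockCount, Set.Ioc_eq_empty_of_le ht.le]
  have hS := h.shocks_locallyFinite
  have hτ : ∀ j < n, Measurable[augHistory P Pi Z X₀ Y₀ t]
      fun ω => shockTime (S ω) (hS ω) t j := fun j hj =>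
    measurable_shockTime_augHistory hS (ih j hj) t
  have hσ : Measurable[augHistory P Pi Z X₀ Y₀ t]
      fun ω => if n = 0 then 0 else shockTime (S ω) (hS ω) t (n - 1) := by
    split_ifs with h0
    · exact measurable_const
    · exact hτ _ (by omega)
  have hI : Measurable[augHistory P Pi Z X₀ Y₀ t] fun ω => (X₀ ω, Y₀ ω) :=
    Measurable.mono (comap_measurable _) (le_sup_right.trans (history_le_augHistory t)) le_rfl
  have hZ : Measurable[augHistory P Pi Z X₀ Y₀ t] fun ω n => Z n ω :=
    Measurable.mono (comap_measurable _)
      ((le_sup_right.trans le_sup_left).trans (history_le_augHistory t)) le_rfl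
  have hW : Measurable[augHistory P Pi Z X₀ Y₀ t] fun ω => ∑ j ∈ Finset.range n, Z j ω :=
    @Finset.measurable_sum _ _ _ _ _ _ (augHistory P Pi Z X₀ Y₀ t) _ _
      fun j _ => (measurable_pi_apply j).comp hZ
  have hreg := @measurableSet_region Ω (augHistory P Pi Z X₀ Y₀ t) _ _ _ _ n _ _ c α k t
    (h.response.mono.leftLim.measurable) hσ (measurable_fst.comp hI) (measurable_snd.comp hI) hW hτ
  obtain ⟨f, hf, hfe⟩ := @exists_measurable_section Ω (augHistory P Pi Z X₀ Y₀ t) Pi t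
    (fun C hC hCt => (measurable_fieldSigma Pi hC hCt).mono
      ((le_sup_left.trans le_sup_left).trans (history_le_augHistory t)) le_rfl) _ hreg
    (by
      rintro ⟨ω, p⟩ ⟨h1, h2, -⟩
      refine ⟨lt_of_le_of_lt ?_ h1, h2⟩
      dsimp only
      split_ifs
      exacts [le_rfl, shockTime_nonneg (hS ω) ht _])
  -- The thinning equation and the local finiteness of the field hold only almost surely; this is
  -- why the history is augmented by null sets.
  refine measurableSet_augHistory_congr (B := {ω | 0 < f ω}) (hf measurableSet_Ioi) ?_
  filter_upwards [h.thinning, h.poissonField.ae_locallyFinite] with ω h1 h2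
  rw [← hfe ω fun K => h2 t K]
  exact lt_shockCount_iff_field_pos h.response.mono h.c_pos (hS ω) h1 ht n rfl

theorem IsEarthquakeModel.measurable_shockCount_augHistory
    (h : IsEarthquakeModel P φ c α k Pi Z X₀ Y₀ S) (t : ℝ) :
    Measurable[augHistory P Pi Z X₀ Y₀ t] fun ω => shockCount (S ω) t :=
  @measurable_of_Ioi _ _ _ _ _ (augHistory P Pi Z X₀ Y₀ t) _ _ _ _
    fun n => h.measurableSet_lt_shockCount n t

/-- The intensity at time `t` is determined by the history up to time `t`. -/
theorem IsEarthquakeModel.measurable_totalIntensity_augHistory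
    (h : IsEarthquakeModel P φ c α k Pi Z X₀ Y₀ S) (t : ℝ) :
    Measurable[augHistory P Pi Z X₀ Y₀ t] (totalIntensity φ c α k Z X₀ Y₀ S t) := by
  have hS := h.shocks_locallyFinite
  have hI : Measurable[augHistory P Pi Z X₀ Y₀ t] fun ω => (X₀ ω, Y₀ ω) :=
    Measurable.mono (comap_measurable _) (le_sup_right.trans (history_le_augHistory t)) le_rfl
  have hZ : Measurable[augHistory P Pi Z X₀ Y₀ t] fun ω n => Z n ω :=
    Measurable.mono (comap_measurable _)
      ((le_sup_right.trans le_sup_left).trans (history_le_augHistory t)) le_rfl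
  have hτ : ∀ j, Measurable[augHistory P Pi Z X₀ Y₀ t]
      fun ω => shockTime (S ω) (hS ω) t j := fun j =>
    measurable_shockTime_augHistory hS (fun r => h.measurableSet_lt_shockCount j r) t
  have hN := h.measurable_shockCount_augHistory t
  have e : totalIntensity φ c α k Z X₀ Y₀ S t = fun ω =>
      φ (X₀ ω + c * t - ∑ n ∈ Finset.range (shockCount (S ω) t), Z n ω) +
        (Y₀ ω * Real.exp (-α * t) + k * ∑ j ∈ Finset.range (shockCount (S ω) t),
          Real.exp (-α * (t - shockTime (S ω) (hS ω) t j))) := by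
    funext ω
    simp only [totalIntensity, primaryIntensity, secondaryIntensity, stress,
      finsum_shocks_eq (hS ω) le_rfl fun r => Real.exp (-α * (t - r))]
  rw [e]
  exact @measurable_intensity_formula Ω (augHistory P Pi Z X₀ Y₀ t) _ _ _ _ _ _ c α k t
    h.response.mono.measurable (measurable_fst.comp hI) (measurable_snd.comp hI)
    (fun j => (measurable_pi_apply j).comp hZ) hτ hN

end Adapted

/-! ### Limits of sets and approximation by strips over a grid -/

theorem measure_le_liminf_of_eventually_mem {β : Type*} [MeasurableSpace β] (μ : Measure β)
    {A : Set β} {R : ℕ → Set β} (h : ∀ p ∈ A, ∀ᶠ m in atTop, p ∈ R m) :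
    μ A ≤ liminf (fun m => μ (R m)) atTop := by
  have hA : A ⊆ ⋃ n, ⋂ m ≥ n, R m := by
    intro p hp
    obtain ⟨n, hn⟩ := eventually_atTop.1 (h p hp)
    exact Set.mem_iUnion.2 ⟨n, Set.mem_iInter₂.2 hn⟩
  have hmono : Monotone fun n => ⋂ m ≥ n, R m := fun a b hab =>
    Set.iInter₂_mono' fun m hm => ⟨m, hab.trans hm, subset_rfl⟩
  rw [liminf_eq_iSup_iInf_of_nat]
  refine (measure_mono hA).trans ?_
  rw [hmono.measure_iUnion]
  exact iSup_mono fun n => le_iInf₂ fun m hm => measure_mono (Set.iInter₂_subset m hm)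

theorem limsup_measure_le_of_frequently_mem {β : Type*} [MeasurableSpace β] (μ : Measure β)
    {A B : Set β} {R : ℕ → Set β} (hR : ∀ m, MeasurableSet (R m)) (hB : ∀ m, R m ⊆ B)
    (hμB : μ B ≠ ∞) (h : ∀ p, (∃ᶠ m in atTop, p ∈ R m) → p ∈ A) :
    limsup (fun m => μ (R m)) atTop ≤ μ A := by
  have hA : (⋂ n, ⋃ m ≥ n, R m) ⊆ A := by
    intro p hp
    refine h p (frequently_atTop.2 fun n => ?_)
    obtain ⟨m, hm, hpm⟩ := Set.mem_iUnion₂.1 (Set.mem_iInter.1 hp n)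
    exact ⟨m, hm, hpm⟩
  have hanti : Antitone fun n => ⋃ m ≥ n, R m := fun a b hab =>
    Set.iUnion₂_mono' fun m hm => ⟨m, le_trans hab hm, subset_rfl⟩
  rw [limsup_eq_iInf_iSup_of_nat]
  refine le_trans ?_ (measure_mono hA)
  rw [hanti.measure_iInter]
  · exact iInf_mono fun n => iSup₂_le fun m hm => measure_mono
      (Set.subset_iUnion₂ (s := fun m (_ : m ≥ n) => R m) m hm)
  · exact fun n => (MeasurableSet.iUnion fun m => MeasurableSet.iUnion fun _ =>
      hR m).nullMeasurableSet
  · exact ⟨0, ne_top_of_le_ne_top hμB (measure_mono (Set.iUnion₂_subset fun m _ => hB m))⟩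

/-- The union of the strips over the `m` cells of a regular grid of `(0, t]` whose heights are the
values of `H` at the left end points of the cells. -/
def gridRegion (H : ℝ → ℝ) (t : ℝ) (m : ℕ) : Set (ℝ × ℝ) :=
  ⋃ i ∈ Finset.range m, Set.Ioc (i * t / m) ((i + 1 : ℕ) * t / m) ×ˢ Set.Iic (H (i * t / m))

theorem mem_grid_cell_iff {t s : ℝ} (ht : 0 < t) {m : ℕ} (hm : 0 < m) (i : ℕ) :
    s ∈ Set.Ioc (i * t / m : ℝ) ((i + 1 : ℕ) * t / m) ↔ ⌈s * m / t⌉₊ = i + 1 := by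
  have hm' : (0 : ℝ) < m := by exact_mod_cast hm
  rw [Nat.ceil_eq_iff (by omega), Set.mem_Ioc, div_lt_iff₀ hm', le_div_iff₀ hm', lt_div_iff₀ ht,
    div_le_iff₀ ht]
  simp

theorem grid_index_mem {t s : ℝ} (ht : 0 < t) (hs : s ∈ Set.Ioc 0 t) {m : ℕ} (hm : 0 < m) :
    ⌈s * m / t⌉₊ - 1 < m ∧ ⌈s * m / t⌉₊ = (⌈s * m / t⌉₊ - 1) + 1 := by
  have hm' : (0 : ℝ) < m := by exact_mod_cast hm
  have h0 : 0 < ⌈s * m / t⌉₊ := Nat.ceil_pos.2 (div_pos (mul_pos hs.1 hm') ht)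
  have h1 : ⌈s * m / t⌉₊ ≤ m := by
    rw [Nat.ceil_le, div_le_iff₀ ht, mul_comm]
    exact mul_le_mul_of_nonneg_left hs.2 hm'.le
  omega

theorem mem_gridRegion_iff {H : ℝ → ℝ} {t : ℝ} (ht : 0 < t) {m : ℕ} (hm : 0 < m) {p : ℝ × ℝ} :
    p ∈ gridRegion H t m ↔ p.1 ∈ Set.Ioc 0 t ∧
      p.2 ≤ H (((⌈p.1 * m / t⌉₊ - 1 : ℕ) : ℝ) * t / m) := by
  have hm' : (0 : ℝ) < m := by exact_mod_cast hm
  simp only [gridRegion, Set.mem_iUnion, Set.mem_prod, Set.mem_Iic, exists_prop, Finset.mem_range]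
  constructor
  · rintro ⟨i, hi, h1, h2⟩
    have h3 := (mem_grid_cell_iff ht hm i).1 h1
    refine ⟨⟨lt_of_le_of_lt (by positivity) h1.1, h1.2.trans ?_⟩, ?_⟩
    · rw [div_le_iff₀ hm', mul_comm]
      exact mul_le_mul_of_nonneg_left (by exact_mod_cast hi) ht.le
    · rwa [h3, Nat.add_sub_cancel]
  · rintro ⟨h1, h2⟩
    obtain ⟨h3, h4⟩ := grid_index_mem ht h1 hm
    exact ⟨_, h3, (mem_grid_cell_iff ht hm _).2 h4, h2⟩

/-- Cells are open on the left, so the left end point of the cell of `s` lies strictly below `s` and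
within `t / m` of it. Sampling at these points therefore recovers left limits. -/
theorem tendsto_grid_left {t s : ℝ} (ht : 0 < t) (hs : s ∈ Set.Ioc 0 t) :
    Tendsto (fun m : ℕ => ((⌈s * m / t⌉₊ - 1 : ℕ) : ℝ) * t / m) atTop (𝓝[<] s) := by
  have hcell : ∀ᶠ m : ℕ in atTop, s ∈ Set.Ioc (((⌈s * m / t⌉₊ - 1 : ℕ) : ℝ) * t / m)
      (((⌈s * m / t⌉₊ - 1) + 1 : ℕ) * t / m) := by
    filter_upwards [eventually_gt_atTop 0] with m hm
    exact (mem_grid_cell_iff ht hm _).2 (grid_index_mem ht hs hm).2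
  refine tendsto_nhdsWithin_iff.2 ⟨?_, hcell.mono fun m hm => hm.1⟩
  have hl : Tendsto (fun m : ℕ => s - t / m) atTop (𝓝 s) := by
    simpa using (tendsto_const_nhds (x := s)).sub (tendsto_const_div_atTop_nhds_zero_nat t)
  refine tendsto_of_tendsto_of_tendsto_of_le_of_le' hl tendsto_const_nhds ?_
    (hcell.mono fun m hm => hm.1.le)
  filter_upwards [hcell] with m hm
  have := hm.2
  push_cast at this ⊢
  rw [add_mul, add_div, one_mul] at this
  linarith

theorem measurableSet_gridRegion (H : ℝ → ℝ) (t : ℝ) (m : ℕ) :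
    MeasurableSet (gridRegion H t m) :=
  Finset.measurableSet_biUnion _ fun _ _ => measurableSet_Ioc.prod measurableSet_Iic

theorem measure_gridRegion (μ : Measure (ℝ × ℝ)) (H : ℝ → ℝ) {t : ℝ} (ht : 0 < t) {m : ℕ}
    (hm : 0 < m) : μ (gridRegion H t m) = ∑ i ∈ Finset.range m,
      μ (Set.Ioc (i * t / m) ((i + 1 : ℕ) * t / m) ×ˢ Set.Iic (H (i * t / m))) := by
  refine measure_biUnion_finset (fun i _ j _ hij => Set.disjoint_left.2 fun p hp hq => hij ?_)
    fun i _ => measurableSet_Ioc.prod measurableSet_Iic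
  have h1 := (mem_grid_cell_iff ht hm i).1 hp.1
  have h2 := (mem_grid_cell_iff ht hm j).1 hq.1
  omega

/-! ### The mean number of shocks -/

section Compensator

variable {Ω : Type*} [MeasurableSpace Ω] {P : Measure Ω}
  {φ : ℝ → ℝ} {c α k : ℝ}
  {Pi : Ω → Measure (ℝ × ℝ)} {Z : ℕ → Ω → ℝ} {X₀ Y₀ : Ω → ℝ} {S : Ω → Set ℝ}

theorem IsEarthquakeModel.totalIntensity_nonneg (h : IsEarthquakeModel P φ c α k Pi Z X₀ Y₀ S)
    {ω : Ω} (hY : 0 ≤ Y₀ ω) (t : ℝ) : 0 ≤ totalIntensity φ c α k Z X₀ Y₀ S t ω :=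
  add_nonneg (h.response.nonneg _) (add_nonneg (by positivity) (mul_nonneg h.k_nonneg
    (finsum_nonneg fun _ => finsum_nonneg fun _ => (Real.exp_pos _).le)))

theorem IsEarthquakeModel.tendsto_leftLim (h : IsEarthquakeModel P φ c α k Pi Z X₀ Y₀ S) (ω : Ω)
    {s : ℝ} (hs : 0 < s) : Tendsto (fun u => totalIntensity φ c α k Z X₀ Y₀ S u ω) (𝓝[<] s)
      (𝓝 (Function.leftLim (fun u => totalIntensity φ c α k Z X₀ Y₀ S u ω) s)) := by
  obtain ⟨a, -, has, ha⟩ := exists_left_const_shocks (h.shocks_locallyFinite ω) s hs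
  exact tendsto_leftLim_of_tendsto
    ⟨_, tendsto_totalIntensity_left α k Z X₀ Y₀ h.response.mono h.c_pos
      (h.shocks_locallyFinite ω) has ha⟩

variable [IsProbabilityMeasure P]

/-- The height over a cell is known at its left end, so `lintegral_strip` applies cell by cell. As
the one-dimensional laws of the intensity agree, the `m` cells contribute equally, and the result
does not depend on `m`. -/
theorem IsEarthquakeModel.lintegral_gridRegion (h : IsEarthquakeModel P φ c α k Pi Z X₀ Y₀ S)
    (hmeas : ∀ t, 0 ≤ t → Measurable (totalIntensity φ c α k Z X₀ Y₀ S t))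
    (hid : ∀ t, 0 ≤ t → IdentDistrib (totalIntensity φ c α k Z X₀ Y₀ S t)
      (totalIntensity φ c α k Z X₀ Y₀ S 0) P P)
    {J : ℝ → ℕ} (hJ : Measurable J) (q : ℝ) {t : ℝ} (ht : 0 < t) {m : ℕ} (hm : 0 < m) :
    Measurable (fun ω => Pi ω (gridRegion
      (fun u => (J (totalIntensity φ c α k Z X₀ Y₀ S u ω) : ℝ) / q) t m)) ∧
    ∫⁻ ω, Pi ω (gridRegion
      (fun u => (J (totalIntensity φ c α k Z X₀ Y₀ S u ω) : ℝ) / q) t m) ∂P =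
    ENNReal.ofReal t *
      ∫⁻ ω, ENNReal.ofReal ((J (totalIntensity φ c α k Z X₀ Y₀ S 0 ω) : ℝ) / q) ∂P := by
  have hm' : (0 : ℝ) < m := by exact_mod_cast hm
  simp only [measure_gridRegion _ _ ht hm]
  have hi : ∀ i : ℕ, 0 ≤ i * t / m := fun i => by positivity
  have hstrip := fun i : ℕ => h.lintegral_strip (hi i) (u := (i + 1 : ℕ) * t / m) (q := q)
    (hJ.comp (hmeas _ (hi i))) (hJ.comp (h.measurable_totalIntensity_augHistory _))
  simp only [Function.comp] at hstrip
  have hg : Measurable fun x : ℝ => ENNReal.ofReal ((J x : ℝ) / q) :=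
    (Measurable.div_const (Measurable.of_discrete.comp hJ) q).ennreal_ofReal
  refine ⟨Finset.measurable_sum _ fun i _ => (hstrip i).1, ?_⟩
  rw [lintegral_finsetSum _ fun i _ => (hstrip i).1]
  have e : ∀ i : ℕ, ∫⁻ ω, Pi ω (Set.Ioc (i * t / m) ((i + 1 : ℕ) * t / m) ×ˢ
      Set.Iic ((J (totalIntensity φ c α k Z X₀ Y₀ S (i * t / m) ω) : ℝ) / q)) ∂P =
      ENNReal.ofReal (t / m) *
        ∫⁻ ω, ENNReal.ofReal ((J (totalIntensity φ c α k Z X₀ Y₀ S 0 ω) : ℝ) / q) ∂P := by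
    intro i
    rw [(hstrip i).2]
    congr 1
    · congr 1
      push_cast
      ring
    · exact ((hid _ (hi i)).comp hg).lintegral_eq
  rw [Finset.sum_congr rfl fun i _ => e i, Finset.sum_const, Finset.card_range, nsmul_eq_mul,
    ← mul_assoc, ← ENNReal.ofReal_natCast, ← ENNReal.ofReal_mul hm'.le, mul_div_cancel₀ _ hm'.ne']

theorem IsEarthquakeModel.lintegral_count_le (h : IsEarthquakeModel P φ c α k Pi Z X₀ Y₀ S)
    (hmeas : ∀ t, 0 ≤ t → Measurable (totalIntensity φ c α k Z X₀ Y₀ S t))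
    (hid : ∀ t, 0 ≤ t → IdentDistrib (totalIntensity φ c α k Z X₀ Y₀ S t)
      (totalIntensity φ c α k Z X₀ Y₀ S 0) P P) {t : ℝ} (ht : 0 < t) {q : ℝ} (hq : 0 < q) :
    ∫⁻ ω, (shockCount (S ω) t : ℝ≥0∞) ∂P ≤ ENNReal.ofReal t *
      ∫⁻ ω, ENNReal.ofReal
        (((⌊totalIntensity φ c α k Z X₀ Y₀ S 0 ω * q⌋₊ + 2 : ℕ) : ℝ) / q) ∂P := by
  -- One unit makes up for rounding down. The other gives slack `1 / q`, so that points on or below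
  -- the left limit are eventually covered although the sampled values only converge to it.
  let J : ℝ → ℕ := fun x => ⌊x * q⌋₊ + 2
  have hJ : Measurable J := (Nat.measurable_floor.comp (measurable_mul_const q)).add_const 2
  let R : Ω → ℕ → Set (ℝ × ℝ) := fun ω m => gridRegion
    (fun u => (J (totalIntensity φ c α k Z X₀ Y₀ S u ω) : ℝ) / q) t (m + 1)
  have hR := fun m : ℕ => h.lintegral_gridRegion hmeas hid hJ q ht m.succ_pos
  have hN : ∀ᵐ ω ∂P, (shockCount (S ω) t : ℝ≥0∞) ≤ liminf (fun m => Pi ω (R ω m)) atTop := by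
    filter_upwards [h.thinning] with ω hω
    rw [hω t ht.le]
    refine measure_le_liminf_of_eventually_mem _ ?_
    rintro p ⟨h1, h2, h3⟩
    have hlim := ((h.tendsto_leftLim ω h1).comp (tendsto_grid_left ht ⟨h1, h2⟩)).comp
      (tendsto_add_atTop_nat 1)
    have hlt : Function.leftLim (fun u => totalIntensity φ c α k Z X₀ Y₀ S u ω) p.1 - 1 / q <
        Function.leftLim (fun u => totalIntensity φ c α k Z X₀ Y₀ S u ω) p.1 :=
      sub_lt_self _ (by positivity)
    filter_upwards [hlim.eventually (lt_mem_nhds hlt)] with m hm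
    refine (mem_gridRegion_iff ht m.succ_pos).2 ⟨⟨h1, h2⟩, h3.trans ?_⟩
    simp only [Function.comp] at hm
    rw [Nat.succ_eq_add_one]
    set x := totalIntensity φ c α k Z X₀ Y₀ S
      (((⌈p.1 * (m + 1 : ℕ) / t⌉₊ - 1 : ℕ) : ℝ) * t / (m + 1 : ℕ)) ω
    have h4 : x * q < ⌊x * q⌋₊ + 1 := Nat.lt_floor_add_one _
    refine le_trans (sub_lt_iff_lt_add.1 hm).le ?_
    rw [le_div_iff₀ hq, add_mul, one_div, inv_mul_cancel₀ hq.ne']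
    simp only [J]
    push_cast
    linarith
  refine (lintegral_mono_ae hN).trans ((lintegral_liminf_le fun m => (hR m).1).trans ?_)
  simp only [(hR _).2, J, liminf_const]
  exact le_rfl

theorem IsEarthquakeModel.le_lintegral_count (h : IsEarthquakeModel P φ c α k Pi Z X₀ Y₀ S)
    (hmeas : ∀ t, 0 ≤ t → Measurable (totalIntensity φ c α k Z X₀ Y₀ S t))
    (hid : ∀ t, 0 ≤ t → IdentDistrib (totalIntensity φ c α k Z X₀ Y₀ S t)
      (totalIntensity φ c α k Z X₀ Y₀ S 0) P P) {t : ℝ} (ht : 0 < t) {q : ℝ} (hq : 0 < q)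
    (K : ℕ) :
    ENNReal.ofReal t * ∫⁻ ω, ENNReal.ofReal
        (((min ⌊totalIntensity φ c α k Z X₀ Y₀ S 0 ω * q⌋₊ K : ℕ) : ℝ) / q) ∂P ≤
      ∫⁻ ω, (shockCount (S ω) t : ℝ≥0∞) ∂P := by
  -- Rounding down needs no slack, since the limiting condition is a closed inequality. The cap `K`
  -- keeps all grid regions in one strip of finite mean mass, the dominating function for the
  -- reverse Fatou lemma.
  let J : ℝ → ℕ := fun x => min ⌊x * q⌋₊ K
  have hJ : Measurable J :=
    (Nat.measurable_floor.comp (measurable_mul_const q)).min measurable_const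
  let R : Ω → ℕ → Set (ℝ × ℝ) := fun ω m => gridRegion
    (fun u => (J (totalIntensity φ c α k Z X₀ Y₀ S u ω) : ℝ) / q) t (m + 1)
  have hR := fun m : ℕ => h.lintegral_gridRegion hmeas hid hJ q ht m.succ_pos
  let B : Set (ℝ × ℝ) := Set.Ioc 0 t ×ˢ Set.Iic ((K : ℝ) / q)
  have hBm : MeasurableSet B := measurableSet_Ioc.prod measurableSet_Iic
  have hv : volume (B ∩ quadrant) < ∞ := by
    rw [volume_strip_inter_quadrant le_rfl]
    exact ENNReal.mul_lt_top ENNReal.ofReal_lt_top ENNReal.ofReal_lt_top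
  have hRB : ∀ ω m, R ω m ⊆ B := by
    intro ω m p hp
    obtain ⟨h1, h2⟩ := (mem_gridRegion_iff ht m.succ_pos).1 hp
    refine ⟨h1, h2.trans ?_⟩
    gcongr
    exact min_le_right _ _
  have hN : ∀ᵐ ω ∂P, limsup (fun m => Pi ω (R ω m)) atTop ≤ (shockCount (S ω) t : ℝ≥0∞) := by
    filter_upwards [h.thinning, h.poissonField.ae_locallyFinite, h.Y₀_nonneg] with ω hω hfin hY
    rw [hω t ht.le]
    refine limsup_measure_le_of_frequently_mem _ (fun m => measurableSet_gridRegion _ _ _)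
      (hRB ω) (hfin _ _).ne ?_
    intro p hp
    obtain ⟨m, hm⟩ := hp.exists
    obtain ⟨⟨h1, h2⟩, -⟩ := hRB ω m hm
    refine ⟨h1, h2, ?_⟩
    have hlim := ((h.tendsto_leftLim ω h1).comp (tendsto_grid_left ht ⟨h1, h2⟩)).comp
      (tendsto_add_atTop_nat 1)
    refine ge_of_tendsto_of_frequently hlim (hp.mono fun m hm => ?_)
    obtain ⟨-, h3⟩ := (mem_gridRegion_iff ht m.succ_pos).1 hm
    refine h3.trans ?_
    simp only [Function.comp]
    rw [Nat.succ_eq_add_one, div_le_iff₀ hq]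
    set x := totalIntensity φ c α k Z X₀ Y₀ S
      (((⌈p.1 * (m + 1 : ℕ) / t⌉₊ - 1 : ℕ) : ℝ) * t / (m + 1 : ℕ)) ω with hx
    have hx0 : 0 ≤ x := by
      exact h.totalIntensity_nonneg hY _
    refine le_trans ?_ (Nat.floor_le (mul_nonneg hx0 hq.le))
    exact_mod_cast min_le_left _ _
  refine le_trans ?_ (lintegral_mono_ae hN)
  have hlim := limsup_lintegral_le (f := fun m ω => Pi ω (R ω m)) (fun ω => Pi ω B)
    (fun m => (hR m).1) (fun m => ae_of_all P fun ω => measure_mono (hRB ω m)) (by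
      rw [h.poissonField.lintegral_apply hBm hv]
      exact hv.ne)
  have he : ∀ m, ∫⁻ ω, Pi ω (R ω m) ∂P = _ := fun m => (hR m).2
  simp only [he, limsup_const] at hlim
  exact hlim

/-- The mean number of shocks is the integrated mean intensity. -/
theorem IsEarthquakeModel.lintegral_count (h : IsEarthquakeModel P φ c α k Pi Z X₀ Y₀ S)
    (hmeas : ∀ t, 0 ≤ t → Measurable (totalIntensity φ c α k Z X₀ Y₀ S t))
    (hid : ∀ t, 0 ≤ t → IdentDistrib (totalIntensity φ c α k Z X₀ Y₀ S t)
      (totalIntensity φ c α k Z X₀ Y₀ S 0) P P) {t : ℝ} (ht : 0 < t) :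
    ∫⁻ ω, (shockCount (S ω) t : ℝ≥0∞) ∂P = ENNReal.ofReal t *
      ∫⁻ ω, ENNReal.ofReal (totalIntensity φ c α k Z X₀ Y₀ S 0 ω) ∂P := by
  have h0 := hmeas 0 le_rfl
  have hpos : ∀ᵐ ω ∂P, 0 ≤ totalIntensity φ c α k Z X₀ Y₀ S 0 ω :=
    h.Y₀_nonneg.mono fun ω hω => h.totalIntensity_nonneg hω 0
  apply le_antisymm
  · have hb : ∀ q : ℕ, ∫⁻ ω, (shockCount (S ω) t : ℝ≥0∞) ∂P ≤ ENNReal.ofReal t *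
        (∫⁻ ω, ENNReal.ofReal (totalIntensity φ c α k Z X₀ Y₀ S 0 ω) ∂P +
          ENNReal.ofReal (2 / (q + 1 : ℕ))) := by
      intro q
      have hq : (0 : ℝ) < (q + 1 : ℕ) := by positivity
      refine (h.lintegral_count_le hmeas hid ht hq).trans (mul_le_mul_right ?_ _)
      have : ∫⁻ _ : Ω, ENNReal.ofReal (2 / (q + 1 : ℕ)) ∂P = ENNReal.ofReal (2 / (q + 1 : ℕ)) := by
        simp
      rw [← this, ← lintegral_add_left h0.ennreal_ofReal]
      refine lintegral_mono_ae (hpos.mono fun ω hω => ?_)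
      rw [← ENNReal.ofReal_add hω (by positivity)]
      refine ENNReal.ofReal_le_ofReal ?_
      rw [div_le_iff₀ hq, add_mul, div_mul_cancel₀ _ hq.ne']
      have := Nat.floor_le (mul_nonneg hω hq.le)
      push_cast at this ⊢
      linarith
    have hlim : Tendsto (fun q : ℕ => ENNReal.ofReal t *
        (∫⁻ ω, ENNReal.ofReal (totalIntensity φ c α k Z X₀ Y₀ S 0 ω) ∂P +
          ENNReal.ofReal (2 / (q + 1 : ℕ)))) atTop (𝓝 (ENNReal.ofReal t *
        (∫⁻ ω, ENNReal.ofReal (totalIntensity φ c α k Z X₀ Y₀ S 0 ω) ∂P + 0))) := by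
      refine ENNReal.Tendsto.const_mul (tendsto_const_nhds.add ?_) (Or.inr ENNReal.ofReal_ne_top)
      rw [← ENNReal.ofReal_zero]
      exact ENNReal.tendsto_ofReal ((tendsto_const_div_atTop_nhds_zero_nat 2).comp
        (tendsto_add_atTop_nat 1))
    rw [add_zero] at hlim
    exact ge_of_tendsto' hlim hb
  -- The cap `(q + 1)²` corresponds to the height `q + 1`, which eventually exceeds any given value
  -- of the intensity while the rounding error `1 / (q + 1)` vanishes.
  · have hb : ∀ q : ℕ, ENNReal.ofReal t * ∫⁻ ω, ENNReal.ofReal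
        (((min ⌊totalIntensity φ c α k Z X₀ Y₀ S 0 ω * (q + 1 : ℕ)⌋₊ ((q + 1) * (q + 1)) : ℕ) : ℝ) /
          (q + 1 : ℕ)) ∂P ≤ ∫⁻ ω, (shockCount (S ω) t : ℝ≥0∞) ∂P := fun q =>
      h.le_lintegral_count hmeas hid ht (by positivity) _
    have hconv : ∀ᵐ ω ∂P, ENNReal.ofReal (totalIntensity φ c α k Z X₀ Y₀ S 0 ω) =
        liminf (fun q : ℕ => ENNReal.ofReal
        (((min ⌊totalIntensity φ c α k Z X₀ Y₀ S 0 ω * (q + 1 : ℕ)⌋₊ ((q + 1) * (q + 1)) : ℕ) : ℝ) /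
          (q + 1 : ℕ))) atTop := by
      filter_upwards [hpos] with ω hω
      refine (Tendsto.liminf_eq (ENNReal.tendsto_ofReal ?_)).symm
      set x := totalIntensity φ c α k Z X₀ Y₀ S 0 ω
      have h1 : Tendsto (fun q : ℕ => (⌊x * (q + 1 : ℕ)⌋₊ : ℝ) / (q + 1 : ℕ)) atTop (𝓝 x) :=
        (tendsto_nat_floor_mul_div_atTop hω).comp
          (tendsto_natCast_atTop_atTop.comp (tendsto_add_atTop_nat 1))
      refine h1.congr' ?_
      obtain ⟨n, hn⟩ := exists_nat_ge x
      filter_upwards [eventually_ge_atTop n] with q hq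
      rw [min_eq_left]
      refine Nat.floor_le_of_le ?_
      push_cast
      have : (n : ℝ) ≤ q := by exact_mod_cast hq
      exact mul_le_mul_of_nonneg_right (by linarith) (by positivity)
    rw [lintegral_congr_ae hconv]
    refine (mul_le_mul_right (lintegral_liminf_le fun q => ?_) _).trans ?_
    · refine Measurable.ennreal_ofReal (Measurable.div_const ?_ _)
      exact Measurable.of_discrete.comp
        ((Nat.measurable_floor.comp (h0.mul_const _)).min measurable_const)
    · rw [← ENNReal.liminf_const_mul_of_ne_top ENNReal.ofReal_ne_top]
      exact (liminf_le_liminf (Eventually.of_forall hb)).trans_eq (liminf_const _)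

end Compensator

/-! ### Stationary processes and convergence to a constant -/

section Stationary

variable {Ω E : Type*} [MeasurableSpace Ω] [MeasurableSpace E] {P : Measure Ω} {V : ℝ≥0 → Ω → E}

theorem IsStationaryProcess.identDistrib_path (h : IsStationaryProcess P V) {β : Type*}
    [MeasurableSpace β] {F : (ℝ≥0 → E) → β} (hF : Measurable F) (s : ℝ≥0) :
    IdentDistrib (fun ω => F fun t => V (s + t) ω) (fun ω => F fun t => V t ω) P P :=
  IdentDistrib.comp (u := F) ⟨(measurable_pi_lambda _ fun t => h.1 (s + t)).aemeasurable,
    (measurable_pi_lambda _ fun t => h.1 t).aemeasurable, h.2 s⟩ hF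

theorem IsStationaryProcess.identDistrib (h : IsStationaryProcess P V) (s : ℝ≥0) :
    IdentDistrib (V s) (V 0) P P := by
  simpa using h.identDistrib_path (measurable_pi_apply 0) s

/-- A stationary process that converges almost surely to a constant is constant. -/
theorem IsStationaryProcess.ae_eq_of_tendsto [IsProbabilityMeasure P] [TopologicalSpace E]
    [TopologicalSpace.MetrizableSpace E] [BorelSpace E] (h : IsStationaryProcess P V) {a : E}
    (ha : ∀ᵐ ω ∂P, Tendsto (fun t => V t ω) atTop (𝓝 a)) (t : ℝ≥0) :
    ∀ᵐ ω ∂P, V t ω = a := by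
  let _ := TopologicalSpace.metrizableSpaceMetric E
  -- Truncating the distance makes dominated convergence applicable; the mean of `g (V s)` is the
  -- same for all `s`, so it equals its limit `0`.
  let g : E → ℝ≥0∞ := fun x => min (edist x a) 1
  have hgc : Continuous g := (continuous_id.edist continuous_const).min continuous_const
  have hg : Measurable g := hgc.measurable
  have hconst : ∀ s, ∫⁻ ω, g (V s ω) ∂P = ∫⁻ ω, g (V t ω) ∂P := fun s =>
    (((h.identDistrib s).trans (h.identDistrib t).symm).comp hg).lintegral_eq
  have hlim : Tendsto (fun n : ℕ => ∫⁻ ω, g (V n ω) ∂P) atTop (𝓝 (∫⁻ _, 0 ∂P)) := by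
    refine tendsto_lintegral_of_dominated_convergence (fun _ => 1) (fun n => hg.comp (h.1 n))
      (fun n => ae_of_all _ fun ω => min_le_right _ _) (by simp) ?_
    filter_upwards [ha] with ω hω
    have h1 := (hgc.tendsto a).comp (hω.comp (tendsto_natCast_atTop_atTop (R := ℝ≥0)))
    simpa [g, Function.comp_def] using h1
  simp only [hconst, lintegral_zero] at hlim
  have h0 := tendsto_nhds_unique tendsto_const_nhds hlim
  rw [lintegral_eq_zero_iff (f := fun ω => g (V t ω)) (hg.comp (h.1 t))] at h0
  filter_upwards [h0] with ω hω
  have : g (V t ω) = 0 := hω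
  have h1 : V t ω = a ∧ edist (V t ω) a ≤ 1 := by simpa [g, min_eq_iff] using this
  exact h1.1

end Stationary

/-! ### Recovering the shocks from the stress path -/

theorem stress_sub_eq_iff {Ω : Type*} {c : ℝ} {Z : ℕ → Ω → ℝ} {X₀ : Ω → ℝ} {S : Ω → Set ℝ} {ω : Ω}
    (hS : ∀ t, (S ω ∩ Set.Ioc 0 t).Finite) (hZ : ∀ n, 0 < Z n ω) {a b : ℝ} (hab : a ≤ b) :
    stress c Z X₀ S b ω - stress c Z X₀ S a ω = c * (b - a) ↔
      shockCount (S ω) b = shockCount (S ω) a := by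
  have hle := shockCount_mono hS hab
  have hsum := Finset.sum_range_add_sum_Ico (fun n => Z n ω) hle
  have hiff : stress c Z X₀ S b ω - stress c Z X₀ S a ω = c * (b - a) ↔
      ∑ n ∈ Finset.Ico (shockCount (S ω) a) (shockCount (S ω) b), Z n ω = 0 := by
    unfold stress
    constructor <;> intro h <;> linarith
  rw [hiff]
  constructor
  · intro h
    by_contra hne
    have hlt := lt_of_le_of_ne hle (Ne.symm hne)
    exact (Finset.sum_pos (fun n _ => hZ n) ⟨_, Finset.mem_Ico.2 ⟨le_rfl, hlt⟩⟩).ne' h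
  · intro h
    rw [h, Finset.Ico_self, Finset.sum_empty]

theorem shockCount_sub {S : Set ℝ} (hS : ∀ t, (S ∩ Set.Ioc 0 t).Finite) {a b : ℝ} (ha : 0 ≤ a)
    (hab : a ≤ b) : shockCount S b - shockCount S a = (S ∩ Set.Ioc a b).ncard := by
  have hU : S ∩ Set.Ioc 0 b = (S ∩ Set.Ioc 0 a) ∪ (S ∩ Set.Ioc a b) := by
    rw [← Set.inter_union_distrib_left, Set.Ioc_union_Ioc_eq_Ioc ha hab]
  have hd : Disjoint (S ∩ Set.Ioc 0 a) (S ∩ Set.Ioc a b) :=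
    Set.disjoint_left.2 fun x hx hy => absurd hx.2.2 (not_le.2 hy.2.1)
  have hf : (S ∩ Set.Ioc a b).Finite := (hS b).subset
    (Set.inter_subset_inter_right _ (Set.Ioc_subset_Ioc_left ha))
  rw [shockCount, shockCount, hU, Set.ncard_union_eq hd (hS a) hf, Nat.add_sub_cancel_left]

/-- On a fine grid the number of cells that contain a shock is the number of shocks. -/
theorem eventually_sum_grid_eq {S : Set ℝ} (hS : ∀ t, (S ∩ Set.Ioc 0 t).Finite) {s : ℝ}
    (hs : 0 ≤ s) : ∀ᶠ m : ℕ in atTop, (∑ i ∈ Finset.range m,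
      if shockCount S (s + (i + 1 : ℕ) / m) = shockCount S (s + i / m) then 0 else 1) =
      shockCount S (s + 1) - shockCount S s := by
  -- Once the mesh is below the smallest gap between the finitely many shocks, every cell contains
  -- at most one.
  have hsep : ∀ᶠ m : ℕ in atTop, ∀ x ∈ S ∩ Set.Ioc 0 (s + 1), ∀ y ∈ S ∩ Set.Ioc 0 (s + 1),
      x < y → 1 / (m : ℝ) < y - x := by
    refine (eventually_all_finite (hS _)).2 fun x _ => (eventually_all_finite (hS _)).2 fun y _ => ?_
    rcases lt_or_ge x y with hxy | hxy
    · filter_upwards [tendsto_one_div_atTop_nhds_zero_nat.eventually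
        (gt_mem_nhds (sub_pos.2 hxy))] with m hm _
      exact hm
    · exact Eventually.of_forall fun m h => absurd h (not_lt.2 hxy)
  filter_upwards [hsep, eventually_gt_atTop 0] with m hm hm0
  have hm' : (0 : ℝ) < m := by exact_mod_cast hm0
  have hcell : ∀ i < m, (if shockCount S (s + (i + 1 : ℕ) / m) = shockCount S (s + i / m)
      then 0 else 1) = shockCount S (s + (i + 1 : ℕ) / m) - shockCount S (s + i / m) := by
    intro i hi
    have h0 : 0 ≤ s + i / m := by positivity
    have hab : s + i / m ≤ s + (i + 1 : ℕ) / (m : ℝ) := by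
      gcongr
      omega
    have hb : s + (i + 1 : ℕ) / (m : ℝ) ≤ s + 1 := by
      gcongr
      rw [div_le_one hm']
      exact_mod_cast hi
    have hmono := shockCount_mono hS hab
    have hone : shockCount S (s + (i + 1 : ℕ) / m) - shockCount S (s + i / m) ≤ 1 := by
      rw [shockCount_sub hS h0 hab]
      have hsub : S ∩ Set.Ioc (s + i / m) (s + (i + 1 : ℕ) / m) ⊆ S ∩ Set.Ioc 0 (s + 1) :=
        Set.inter_subset_inter_right _ (Set.Ioc_subset_Ioc h0 hb)
      have hlt : ∀ x ∈ S ∩ Set.Ioc (s + i / m) (s + (i + 1 : ℕ) / m),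
          ∀ y ∈ S ∩ Set.Ioc (s + i / m) (s + (i + 1 : ℕ) / m), ¬ x < y := by
        intro x hx y hy hxy
        have h1 := hm x (hsub hx) y (hsub hy) hxy
        have h2 := hx.2.1
        have h3 := hy.2.2
        push_cast at h3
        rw [add_div] at h3
        linarith
      rw [Set.ncard_le_one ((hS _).subset hsub)]
      intro x hx y hy
      exact le_antisymm (not_lt.1 (hlt y hy x hx)) (not_lt.1 (hlt x hx y hy))
    split_ifs with h
    · omega
    · omega
  rw [Finset.sum_congr rfl fun i hi => hcell i (Finset.mem_range.1 hi)]
  have htel := Finset.sum_range_tsub (f := fun i : ℕ => shockCount S (s + i / m)) (fun i j hij =>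
    shockCount_mono hS (by gcongr)) m
  rw [htel]
  simp [hm'.ne']

/-! ### Stress balance and the rate of shocks -/

section Rates

variable {Ω : Type*} [MeasurableSpace Ω] {P : Measure Ω}
  {φ : ℝ → ℝ} {c α k : ℝ}
  {Pi : Ω → Measure (ℝ × ℝ)} {Z : ℕ → Ω → ℝ} {X₀ Y₀ : Ω → ℝ} {S : Ω → Set ℝ}

theorem IsEarthquakeModel.identDistrib_count (h : IsEarthquakeModel P φ c α k Pi Z X₀ Y₀ S)
    (hstat : IsStationaryProcess P
      (fun (t : ℝ≥0) ω => (stress c Z X₀ S t ω, secondaryIntensity α k Y₀ S t ω))) (s : ℝ≥0) :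
    IdentDistrib (fun ω => ((shockCount (S ω) (s + 1) - shockCount (S ω) s : ℕ) : ℝ))
      (fun ω => (shockCount (S ω) 1 : ℝ)) P P := by
  classical
  -- This counts the cells in which the stress fails to grow by exactly `c / m`, that is, those with
  -- a shock. It uses finitely many coordinates of the path, so its limsup over `m` is a measurable
  -- functional on the product σ-field to which stationarity applies.
  let F : ℕ → (ℝ≥0 → ℝ × ℝ) → ℝ≥0∞ := fun m v => ∑ i ∈ Finset.range m,
    if (v ((i + 1 : ℕ) / m)).1 - (v (i / m)).1 = c * (1 / m) then 0 else 1
  have hF : ∀ m, Measurable (F m) := by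
    intro m
    refine Finset.measurable_sum _ fun i _ => Measurable.ite ?_ measurable_const measurable_const
    exact measurableSet_eq_fun ((measurable_fst.comp (measurable_pi_apply _)).sub
      (measurable_fst.comp (measurable_pi_apply _))) measurable_const
  let G : (ℝ≥0 → ℝ × ℝ) → ℝ := fun v => (limsup (fun m => F m v) atTop).toReal
  have hG : Measurable G := (Measurable.limsup hF).ennreal_toReal
  have hZ : ∀ᵐ ω ∂P, ∀ n, 0 < Z n ω := ae_all_iff.2 h.Z_pos
  have hlim : ∀ s : ℝ≥0, ∀ᵐ ω ∂P, G (fun t => (stress c Z X₀ S (s + t : ℝ≥0) ω,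
      secondaryIntensity α k Y₀ S (s + t : ℝ≥0) ω)) =
      ((shockCount (S ω) (s + 1) - shockCount (S ω) s : ℕ) : ℝ) := by
    intro s
    filter_upwards [hZ] with ω hω
    have hS := h.shocks_locallyFinite ω
    have hT : Tendsto (fun m => F m (fun t => (stress c Z X₀ S (s + t : ℝ≥0) ω,
        secondaryIntensity α k Y₀ S (s + t : ℝ≥0) ω))) atTop
        (𝓝 ((shockCount (S ω) (s + 1) - shockCount (S ω) s : ℕ) : ℝ≥0∞)) := by
      refine tendsto_const_nhds.congr' ?_
      filter_upwards [eventually_sum_grid_eq hS s.2, eventually_gt_atTop 0] with m hm hm0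
      have hm' : (0 : ℝ) < m := by exact_mod_cast hm0
      change ((shockCount (S ω) (↑s + 1) - shockCount (S ω) ↑s : ℕ) : ℝ≥0∞) = _
      erw [← hm]
      rw [Nat.cast_sum]
      refine Finset.sum_congr rfl fun i _ => ?_
      have hab : (s : ℝ) + i / m ≤ s + (i + 1 : ℕ) / (m : ℝ) := by
        gcongr
        omega
      have hiff := stress_sub_eq_iff (c := c) (X₀ := X₀) hS hω hab
      have hd : (s : ℝ) + (i + 1 : ℕ) / (m : ℝ) - (s + i / m) = 1 / m := by
        push_cast
        ring
      rw [hd] at hiff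
      by_cases hc : shockCount (S ω) (s + (i + 1 : ℕ) / (m : ℝ)) = shockCount (S ω) (s + i / m)
      · have h2 := hiff.2 hc
        rw [if_pos (by exact hc)]
        push_cast at h2 ⊢
        rw [if_pos h2]
      · have h2 := mt hiff.1 hc
        rw [if_neg (by exact hc)]
        push_cast at h2 ⊢
        rw [if_neg h2]
    change ENNReal.toReal (limsup _ atTop) = _
    rw [hT.limsup_eq, ENNReal.toReal_natCast]
  have h0 : ∀ᵐ ω ∂P, G (fun t => (stress c Z X₀ S (t : ℝ≥0) ω,
      secondaryIntensity α k Y₀ S (t : ℝ≥0) ω)) = (shockCount (S ω) 1 : ℝ) := by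
    filter_upwards [hlim 0] with ω hω
    simpa [shockCount_zero] using hω
  have hid := hstat.identDistrib_path hG s
  exact ((IdentDistrib.of_ae_eq hid.aemeasurable_fst (hlim s)).symm.trans hid).trans
    (IdentDistrib.of_ae_eq hid.aemeasurable_snd h0)

theorem tendstoInMeasure_of_identDistrib {f g : ℕ → Ω → ℝ}
    (hfg : ∀ n, IdentDistrib (f n) (g n) P P) (hg : TendstoInMeasure P g atTop fun _ => 0) :
    TendstoInMeasure P f atTop fun _ => 0 := by
  intro ε hε
  refine (hg ε hε).congr fun n => ?_
  have hm : MeasurableSet {x : ℝ | ε ≤ edist x 0} :=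
    measurableSet_le measurable_const (measurable_id.edist measurable_const)
  exact ((hfg n).measure_mem_eq hm).symm

/-- The hypothesis on the stress says that the released stress per unit of time tends to `c`. As `c
> 0`, the count must tend to infinity, so the law of large numbers can be evaluated at `N`, and the
quotient of the two limits is the rate. -/
theorem tendsto_count_div_of_stress {N : ℕ → ℕ} (hN : Monotone N) {z : ℕ → ℝ}
    (hz : ∀ n, 0 < z n) {x μ : ℝ} (hc : 0 < c) (hμ : 0 < μ) {ns : ℕ → ℕ}
    (hns : Tendsto ns atTop atTop)
    (hslln : Tendsto (fun n : ℕ => (∑ i ∈ Finset.range n, z i) / n) atTop (𝓝 μ))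
    (hX : Tendsto (fun m => (x + c * ns m - ∑ i ∈ Finset.range (N (ns m)), z i) / ns m) atTop
      (𝓝 0)) :
    Tendsto (fun m => (N (ns m) : ℝ) / ns m) atTop (𝓝 (c / μ)) := by
  have hQ : Tendsto (fun m => (∑ i ∈ Finset.range (N (ns m)), z i) / (ns m : ℝ)) atTop (𝓝 c) := by
    have h1 : Tendsto (fun m => x / (ns m : ℝ) + c) atTop (𝓝 (0 + c)) :=
      ((tendsto_const_div_atTop_nhds_zero_nat x).comp hns).add_const c
    have h2 := h1.sub hX
    rw [zero_add, sub_zero] at h2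
    refine h2.congr' ?_
    filter_upwards [hns.eventually_gt_atTop 0] with m hm
    have : (ns m : ℝ) ≠ 0 := by exact_mod_cast hm.ne'
    field_simp
    ring
  have hNtop : Tendsto (fun m => N (ns m)) atTop atTop := by
    refine Tendsto.comp ?_ hns
    refine (tendsto_atTop_atTop_of_monotone hN) fun b => ?_
    by_contra! hb
    have h0 : Tendsto (fun m => (∑ i ∈ Finset.range (N (ns m)), z i) / (ns m : ℝ)) atTop (𝓝 0) := by
      refine squeeze_zero (fun m => div_nonneg (Finset.sum_nonneg fun i _ => (hz i).le)
        (Nat.cast_nonneg _)) (fun m => ?_)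
        ((tendsto_const_div_atTop_nhds_zero_nat (∑ i ∈ Finset.range b, z i)).comp hns)
      exact div_le_div_of_nonneg_right (Finset.sum_le_sum_of_subset_of_nonneg
        (Finset.range_subset_range.2 (hb _).le) fun i _ _ => (hz i).le) (Nat.cast_nonneg _)
    exact hc.ne (tendsto_nhds_unique h0 hQ)
  refine (hQ.div (hslln.comp hNtop) hμ.ne').congr' ?_
  filter_upwards [hNtop.eventually_gt_atTop 0, hns.eventually_gt_atTop 0] with m h1 h2
  have h1' : (N (ns m) : ℝ) ≠ 0 := by exact_mod_cast h1.ne'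
  have h2' : (ns m : ℝ) ≠ 0 := by exact_mod_cast h2.ne'
  have h3 : ∑ i ∈ Finset.range (N (ns m)), z i ≠ 0 :=
    (Finset.sum_pos (fun i _ => hz i) ⟨0, Finset.mem_range.2 h1⟩).ne'
  simp only [Function.comp, Pi.div_apply]
  field_simp

variable [IsProbabilityMeasure P]

/-- The mean number of shocks per unit of time is the ratio of the speed of the stress build-up
and the mean stress release. -/
theorem IsEarthquakeModel.integral_count_one (h : IsEarthquakeModel P φ c α k Pi Z X₀ Y₀ S)
    (hstat : IsStationaryProcess P
      (fun (t : ℝ≥0) ω => (stress c Z X₀ S t ω, secondaryIntensity α k Y₀ S t ω)))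
    (hint : Integrable (fun ω => (shockCount (S ω) 1 : ℝ)) P) :
    ∫ ω, (shockCount (S ω) 1 : ℝ) ∂P = c / ∫ ω, Z 0 ω ∂P := by
  have hZ : ∀ᵐ ω ∂P, ∀ n, 0 < Z n ω := ae_all_iff.2 h.Z_pos
  have hμ : 0 < ∫ ω, Z 0 ω ∂P := by
    rw [integral_pos_iff_support_of_nonneg_ae ((h.Z_pos 0).mono fun _ h => h.le) h.Z_integrable]
    have : P (Function.support (Z 0)) = 1 := by
      rw [prob_compl_eq_zero_iff₀ (measurableSet_support (h.measurable_Z 0)).nullMeasurableSet |>.symm]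
      exact (h.Z_pos 0).mono fun ω hω => hω.ne'
    rw [this]
    exact one_pos
  let W : ℕ → Ω → ℝ := fun j ω => ((shockCount (S ω) (j + 1) - shockCount (S ω) j : ℕ) : ℝ)
  have hWid : ∀ j, IdentDistrib (W j) (W 0) P P := by
    intro j
    have h1 := h.identDistrib_count hstat j
    have h2 := h.identDistrib_count hstat 0
    simp only [NNReal.coe_natCast, NNReal.coe_zero] at h1 h2
    have := h1.trans h2.symm
    simpa [W] using this
  have hW0 : W 0 = fun ω => (shockCount (S ω) 1 : ℝ) := by
    funext ω
    simp [W, shockCount_zero]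
  have hWint : MemLp (W 0) 1 P := by
    rw [hW0]
    exact memLp_one_iff_integrable.2 hint
  have hsum : ∀ n : ℕ, ∀ ω, ∑ j ∈ Finset.range n, W j ω = shockCount (S ω) n := by
    intro n ω
    have := Finset.sum_range_tsub (f := fun i : ℕ => shockCount (S ω) i) (fun i j hij =>
      shockCount_mono (h.shocks_locallyFinite ω) (by exact_mod_cast hij)) n
    simp only [Nat.cast_zero, shockCount_zero, Nat.sub_zero] at this
    rw [← this, Nat.cast_sum]
    simp [W]
  -- The quotient `N(n) / n` is an average of identically distributed integrable increments, hence
  -- uniformly integrable.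
  have hUI := uniformIntegrable_average_real le_rfl
    (MemLp.uniformIntegrable_of_identDistrib le_rfl ENNReal.one_ne_top hWint hWid)
  have havg : (fun n : ℕ => (∑ i ∈ Finset.range n, W i) / (n : Ω → ℝ)) =
      fun (n : ℕ) ω => (shockCount (S ω) n : ℝ) / n := by
    funext n ω
    rw [← hsum n ω]
    simp
  rw [havg] at hUI
  -- Stationarity replaces `X(n) / n` by `X(0) / n` in law, which tends to `0` pointwise. No moment
  -- of `X(0)` is needed.
  have hXm : TendstoInMeasure P (fun (n : ℕ) ω => stress c Z X₀ S n ω / n) atTop fun _ => 0 := by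
    refine tendstoInMeasure_of_identDistrib (g := fun n ω => stress c Z X₀ S 0 ω / n)
      (fun n => ?_) ?_
    · have := (hstat.identDistrib n).comp
        ((measurable_fst : Measurable (Prod.fst : ℝ × ℝ → ℝ)).div_const (n : ℝ))
      simpa [Function.comp_def] using this
    · refine tendstoInMeasure_of_tendsto_ae (fun n => ?_) (ae_of_all _ fun ω =>
        tendsto_const_div_atTop_nhds_zero_nat _)
      have := (hstat.1 0).fst.div_const (n : ℝ)
      simpa using this.aestronglyMeasurable
  obtain ⟨ns, hns, hXae⟩ := hXm.exists_seq_tendsto_ae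
  have hslln := strong_law_ae_real Z h.Z_integrable
    (fun i j hij => h.Z_indep.indepFun hij) h.Z_ident
  have hlim : ∀ᵐ ω ∂P, Tendsto (fun m => (shockCount (S ω) (ns m) : ℝ) / ns m) atTop
      (𝓝 (c / ∫ ω, Z 0 ω ∂P)) := by
    filter_upwards [hZ, hXae, hslln] with ω h1 h2 h3
    exact tendsto_count_div_of_stress (N := fun n : ℕ => shockCount (S ω) n)
      (fun i j hij => shockCount_mono (h.shocks_locallyFinite ω) (by exact_mod_cast hij)) h1
      h.c_pos hμ hns.tendsto_atTop h3 h2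
  have hL1 := tendsto_Lp_finite_of_tendsto_ae (μ := P) le_rfl ENNReal.one_ne_top
    (f := fun m ω => (shockCount (S ω) (ns m) : ℝ) / ns m) (g := fun _ => c / ∫ ω, Z 0 ω ∂P)
    (fun m => hUI.1 (ns m)) (memLp_const _) (fun ε hε => by
      obtain ⟨δ, hδ, h'⟩ := hUI.2.1 hε
      exact ⟨δ, hδ, fun m => h' (ns m)⟩) hlim
  have hi := tendsto_integral_of_L1' _ aestronglyMeasurable_const
    (Eventually.of_forall fun m => memLp_one_iff_integrable.1 (hUI.memLp (ns m))) hL1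
  rw [integral_const, probReal_univ, one_smul] at hi
  -- The mean of `N(n) / n` equals the mean of `N(1)` for every positive `n`, so convergence along a
  -- subsequence suffices.
  refine tendsto_nhds_unique ((tendsto_const_nhds).congr' ?_) hi
  filter_upwards [hns.tendsto_atTop.eventually_gt_atTop 0] with m hm
  have hm' : (ns m : ℝ) ≠ 0 := by exact_mod_cast hm.ne'
  have hWi : ∀ j, Integrable (W j) P := fun j =>
    (hWid j).integrable_iff.2 (memLp_one_iff_integrable.1 hWint)
  simp only [← hsum, integral_div]
  rw [integral_finsetSum _ fun j _ => hWi j, Finset.sum_congr rfl fun j _ => (hWid j).integral_eq,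
    Finset.sum_const, Finset.card_range, nsmul_eq_mul, mul_div_cancel_left₀ _ hm', hW0]

end Rates

/-! ### Aftershock balance and conclusion -/

/-- A shock in `(0, t]` contributes between `k e^{-α t}` and `k` at time `t`. This crude bound loses
nothing to first order as `t → 0`. -/
theorem secondaryIntensity_mem_Icc {Ω : Type*} {α k : ℝ} {Y₀ : Ω → ℝ} {S : Ω → Set ℝ}
    (hα : 0 < α) (hk : 0 ≤ k) {ω : Ω}
    (hS : ∀ t, (S ω ∩ Set.Ioc 0 t).Finite) (t : ℝ) :
    secondaryIntensity α k Y₀ S t ω ∈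
      Set.Icc (Y₀ ω * Real.exp (-α * t) + k * (Real.exp (-α * t) * shockCount (S ω) t))
        (Y₀ ω * Real.exp (-α * t) + k * shockCount (S ω) t) := by
  rw [secondaryIntensity, finsum_mem_eq_finite_toFinset_sum _ (hS t), ← card_toFinset_shocks hS]
  have hmem : ∀ s ∈ (hS t).toFinset, 0 < s ∧ s ≤ t := fun s hs => ((hS t).mem_toFinset.1 hs).2
  constructor
  · gcongr
    rw [mul_comm, ← nsmul_eq_mul]
    refine Finset.card_nsmul_le_sum _ _ _ fun s hs => Real.exp_le_exp.2 ?_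
    nlinarith [(hmem s hs).1]
  · gcongr
    have := Finset.sum_le_card_nsmul (hS t).toFinset (fun s => Real.exp (-α * (t - s))) 1
      fun s hs => Real.exp_le_one_iff.2 (by nlinarith [(hmem s hs).2])
    simpa using this

/-- Dividing by `t` squeezes `y (1 - e^{-α t}) / t` between `e^{-α t} K` and `K`. As `t` decreases
to `0` it tends to `y α`, by the derivative of the exponential. -/
theorem mul_eq_of_forall_exp_bounds {α y K : ℝ}
    (h : ∀ t : ℝ, 0 < t → y * Real.exp (-α * t) + Real.exp (-α * t) * (K * t) ≤ y ∧
      y ≤ y * Real.exp (-α * t) + K * t) : y * α = K := by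
  have hd : HasDerivAt (fun t : ℝ => Real.exp (-α * t)) (-α) 0 := by
    have := ((hasDerivAt_id (0 : ℝ)).const_mul (-α)).exp
    simpa using this
  have hs : Tendsto (fun t : ℝ => y * -(t⁻¹ * (Real.exp (-α * t) - 1))) (𝓝[>] 0) (𝓝 (y * α)) := by
    have := (hd.tendsto_slope_zero_right.neg).const_mul y
    simpa using this
  have he : Tendsto (fun t : ℝ => Real.exp (-α * t) * K) (𝓝[>] 0) (𝓝 K) := by
    have h1 : Continuous fun t : ℝ => Real.exp (-α * t) * K := by fun_prop
    have h2 := (h1.tendsto 0).mono_left (nhdsWithin_le_nhds (s := Set.Ioi 0))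
    simpa using h2
  refine le_antisymm (le_of_tendsto hs ?_) (le_of_tendsto_of_tendsto he hs ?_)
  · filter_upwards [self_mem_nhdsWithin] with t ht
    have ht' : 0 < t := ht
    have e : y * -(t⁻¹ * (Real.exp (-α * t) - 1)) = (y - y * Real.exp (-α * t)) / t := by
      field_simp
      ring
    rw [e, div_le_iff₀ ht']
    linarith [(h t ht').2]
  · filter_upwards [self_mem_nhdsWithin] with t ht
    have ht' : 0 < t := ht
    have e : y * -(t⁻¹ * (Real.exp (-α * t) - 1)) = (y - y * Real.exp (-α * t)) / t := by
      field_simp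
      ring
    rw [e, le_div_iff₀ ht']
    linarith [(h t ht').1]

theorem IsEarthquakeModel.average_rates {Ω : Type*} [MeasurableSpace Ω] {P : Measure Ω}
    [IsProbabilityMeasure P] {φ : ℝ → ℝ} {c α k : ℝ} {Pi : Ω → Measure (ℝ × ℝ)}
    {Z : ℕ → Ω → ℝ} {X₀ Y₀ : Ω → ℝ} {S : Ω → Set ℝ}
    (h : IsEarthquakeModel P φ c α k Pi Z X₀ Y₀ S)
    (hstat : IsStationaryProcess P
      (fun (t : ℝ≥0) ω => (stress c Z X₀ S t ω, secondaryIntensity α k Y₀ S t ω)))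
    (hint : Integrable (totalIntensity φ c α k Z X₀ Y₀ S 0) P) {t : ℝ} (ht : 0 ≤ t) :
    Integrable (primaryIntensity φ c Z X₀ S t) P ∧
    Integrable (secondaryIntensity α k Y₀ S t) P ∧
    ∫ ω, totalIntensity φ c α k Z X₀ Y₀ S t ω ∂P = c / ∫ ω, Z 0 ω ∂P ∧
    ∫ ω, secondaryIntensity α k Y₀ S t ω ∂P =
      (∫ ω, totalIntensity φ c α k Z X₀ Y₀ S t ω ∂P) * (k / α) ∧
    ∫ ω, primaryIntensity φ c Z X₀ S t ω ∂P =
      (∫ ω, totalIntensity φ c α k Z X₀ Y₀ S t ω ∂P) * (1 - k / α) := by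
  have hφ : Measurable φ := h.response.mono.measurable
  have hp1 : Measurable fun x : ℝ × ℝ => φ x.1 := hφ.comp measurable_fst
  have hidV : ∀ t, 0 ≤ t → IdentDistrib
      (fun ω => (stress c Z X₀ S t ω, secondaryIntensity α k Y₀ S t ω))
      (fun ω => (stress c Z X₀ S 0 ω, secondaryIntensity α k Y₀ S 0 ω)) P P := fun t ht => by
    lift t to ℝ≥0 using ht
    simpa using hstat.identDistrib t
  have hidφ : ∀ t, 0 ≤ t → IdentDistrib (primaryIntensity φ c Z X₀ S t)
      (primaryIntensity φ c Z X₀ S 0) P P := fun t ht => (hidV t ht).comp hp1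
  have hidY : ∀ t, 0 ≤ t → IdentDistrib (secondaryIntensity α k Y₀ S t)
      (secondaryIntensity α k Y₀ S 0) P P := fun t ht => (hidV t ht).comp measurable_snd
  have hidΛ : ∀ t, 0 ≤ t → IdentDistrib (totalIntensity φ c α k Z X₀ Y₀ S t)
      (totalIntensity φ c α k Z X₀ Y₀ S 0) P P := fun t ht =>
    (hidV t ht).comp (hp1.add measurable_snd)
  have hmφ : ∀ t, 0 ≤ t → Measurable (primaryIntensity φ c Z X₀ S t) := fun t ht =>
    hp1.comp (hstat.1 ⟨t, ht⟩)
  have hmY : ∀ t, 0 ≤ t → Measurable (secondaryIntensity α k Y₀ S t) := fun t ht =>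
    measurable_snd.comp (hstat.1 ⟨t, ht⟩)
  have hmΛ : ∀ t, 0 ≤ t → Measurable (totalIntensity φ c α k Z X₀ Y₀ S t) := fun t ht =>
    (hmφ t ht).add (hmY t ht)
  have hYnn : ∀ ω, 0 ≤ Y₀ ω → 0 ≤ secondaryIntensity α k Y₀ S 0 ω := fun ω hω =>
    add_nonneg (by positivity) (mul_nonneg h.k_nonneg
      (finsum_nonneg fun _ => finsum_nonneg fun _ => (Real.exp_pos _).le))
  have hφ0 : Integrable (primaryIntensity φ c Z X₀ S 0) P := by
    refine hint.mono' (hmφ 0 le_rfl).aestronglyMeasurable (h.Y₀_nonneg.mono fun ω hω => ?_)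
    rw [Real.norm_of_nonneg (show 0 ≤ primaryIntensity φ c Z X₀ S 0 ω from h.response.nonneg _)]
    exact le_add_of_nonneg_right (hYnn ω hω)
  have hY0 : Integrable (secondaryIntensity α k Y₀ S 0) P := by
    refine hint.mono' (hmY 0 le_rfl).aestronglyMeasurable (h.Y₀_nonneg.mono fun ω hω => ?_)
    rw [Real.norm_of_nonneg (hYnn ω hω)]
    exact le_add_of_nonneg_left (h.response.nonneg _)
  set L := ∫ ω, totalIntensity φ c α k Z X₀ Y₀ S 0 ω ∂P with hL
  have hΛnn : 0 ≤ᵐ[P] totalIntensity φ c α k Z X₀ Y₀ S 0 :=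
    h.Y₀_nonneg.mono fun ω hω => h.totalIntensity_nonneg hω 0
  have hLnn : 0 ≤ L := integral_nonneg_of_ae hΛnn
  have hNm : ∀ t, Measurable fun ω => (shockCount (S ω) t : ℝ) := fun t =>
    Measurable.of_discrete.comp (h.measurable_count t)
  have hNl : ∀ t, 0 < t → ∫⁻ ω, ENNReal.ofReal (shockCount (S ω) t : ℝ) ∂P =
      ENNReal.ofReal (t * L) := by
    intro t ht
    simp only [ENNReal.ofReal_natCast]
    rw [h.lintegral_count hmΛ hidΛ ht, ← ofReal_integral_eq_lintegral_ofReal hint hΛnn,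
      ENNReal.ofReal_mul ht.le]
  have hNnn : ∀ t, 0 ≤ᵐ[P] fun ω => (shockCount (S ω) t : ℝ) := fun t =>
    ae_of_all _ fun ω => Nat.cast_nonneg _
  have hNi : ∀ t, 0 < t → Integrable (fun ω => (shockCount (S ω) t : ℝ)) P := by
    intro t ht
    refine ⟨(hNm t).aestronglyMeasurable, ?_⟩
    rw [hasFiniteIntegral_iff_ofReal (hNnn t), hNl t ht]
    exact ENNReal.ofReal_lt_top
  have hNI : ∀ t, 0 < t → ∫ ω, (shockCount (S ω) t : ℝ) ∂P = t * L := by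
    intro t ht
    rw [integral_eq_lintegral_of_nonneg_ae (hNnn t) (hNm t).aestronglyMeasurable, hNl t ht,
      ENNReal.toReal_ofReal (mul_nonneg ht.le hLnn)]
  have hLc : L = c / ∫ ω, Z 0 ω ∂P := by
    have := h.integral_count_one hstat (hNi 1 one_pos)
    rwa [hNI 1 one_pos, one_mul] at this
  have hY0e : secondaryIntensity α k Y₀ S 0 = Y₀ := by
    funext ω
    simp [secondaryIntensity]
  -- Taking means in the bounds for `Y(t)`, with `E[Y(t)] = E[Y(0)]` and `E[N(t)] = t L`, gives the
  -- inequalities of `mul_eq_of_forall_exp_bounds` with `K = k L`.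
  have hmean : (∫ ω, secondaryIntensity α k Y₀ S 0 ω ∂P) * α = k * L := by
    refine mul_eq_of_forall_exp_bounds fun t ht => ?_
    have hYt := (hidY t ht.le).integral_eq
    have hYti : Integrable (secondaryIntensity α k Y₀ S t) P :=
      (hidY t ht.le).integrable_iff.2 hY0
    have hY0i : Integrable Y₀ P := hY0e ▸ hY0
    have hb := fun ω => secondaryIntensity_mem_Icc (Y₀ := Y₀) h.alpha_pos h.k_nonneg
      (h.shocks_locallyFinite ω) t
    have h1 := integral_mono ((hY0i.mul_const _).add (((hNi t ht).const_mul _).const_mul k)) hYti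
      fun ω => (hb ω).1
    have h2 := integral_mono hYti ((hY0i.mul_const _).add ((hNi t ht).const_mul k))
      fun ω => (hb ω).2
    rw [integral_add' (hY0i.mul_const _) (((hNi t ht).const_mul _).const_mul k),
      integral_mul_const, integral_const_mul, integral_const_mul, hNI t ht, hYt] at h1
    rw [integral_add' (hY0i.mul_const _) ((hNi t ht).const_mul k),
      integral_mul_const, integral_const_mul, hNI t ht, hYt] at h2
    rw [hY0e] at h1 h2 ⊢
    constructor <;> linarith
  have hsplit : L = ∫ ω, primaryIntensity φ c Z X₀ S 0 ω ∂P +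
      ∫ ω, secondaryIntensity α k Y₀ S 0 ω ∂P := integral_add hφ0 hY0
  have hα := h.alpha_pos.ne'
  have hYL : ∫ ω, secondaryIntensity α k Y₀ S 0 ω ∂P = L * (k / α) := by
    rw [mul_div_assoc', eq_div_iff hα, hmean, mul_comm]
  rw [(hidΛ t ht).integral_eq, (hidY t ht).integral_eq, (hidφ t ht).integral_eq]
  exact ⟨(hidφ t ht).integrable_iff.2 hφ0, (hidY t ht).integrable_iff.2 hY0, hLc, hYL, by linarith⟩

theorem mainTheorem5 {Ω : Type*} [MeasurableSpace Ω] (P : Measure Ω) [IsProbabilityMeasure P] :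
    -- the average rates of the model in the stationary ergodic regime with `0 < λ < ∞`
    (∀ (φ : ℝ → ℝ) (c α k : ℝ) (Pi : Ω → Measure (ℝ × ℝ)) (Z : ℕ → Ω → ℝ)
      (X₀ Y₀ : Ω → ℝ) (S : Ω → Set ℝ),
      IsEarthquakeModel P φ c α k Pi Z X₀ Y₀ S →
      IsStationaryProcess P
        (fun (t : ℝ≥0) ω => (stress c Z X₀ S t ω, secondaryIntensity α k Y₀ S t ω)) →
      IsErgodicProcess P
        (fun (t : ℝ≥0) ω => (stress c Z X₀ S t ω, secondaryIntensity α k Y₀ S t ω)) →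
      Integrable (totalIntensity φ c α k Z X₀ Y₀ S 0) P →
      0 < ∫ ω, totalIntensity φ c α k Z X₀ Y₀ S 0 ω ∂P →
      ∀ t : ℝ, 0 ≤ t →
        Integrable (primaryIntensity φ c Z X₀ S t) P ∧
        Integrable (secondaryIntensity α k Y₀ S t) P ∧
        ∫ ω, totalIntensity φ c α k Z X₀ Y₀ S t ω ∂P = c / ∫ ω, Z 0 ω ∂P ∧
        ∫ ω, secondaryIntensity α k Y₀ S t ω ∂P =
          (∫ ω, totalIntensity φ c α k Z X₀ Y₀ S t ω ∂P) * (k / α) ∧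
        ∫ ω, primaryIntensity φ c Z X₀ S t ω ∂P =
          (∫ ω, totalIntensity φ c α k Z X₀ Y₀ S t ω ∂P) * (1 - k / α)) ∧
    -- a stationary process that converges almost surely to a constant
    (∀ (E : Type*) [TopologicalSpace E] [TopologicalSpace.MetrizableSpace E]
      [MeasurableSpace E] [BorelSpace E] (V : ℝ≥0 → Ω → E) (a : E), IsStationaryProcess P V →
      (∀ᵐ ω ∂P, Tendsto (fun t => V t ω) atTop (𝓝 a)) →
      ∀ t : ℝ≥0, ∀ᵐ ω ∂P, V t ω = a) := by
  refine ⟨?_, fun E _ _ _ _ V a hV ha t => hV.ae_eq_of_tendsto ha t⟩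
  intro φ c α k Pi Z X₀ Y₀ S h hstat _ hint _ t ht
  exact h.average_rates hstat hint ht
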